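/- Let $d\ge 0$ and let $\Omega$ be either $C_0([0,\infty),\mathbb R^d)$ (continuous paths vanishing at $0$, with uniform convergence on compact sets), or $D([0,\infty),\mathbb R^d)$ or $D_0([0,\infty),\mathbb R^d)$ (càdlàg paths, resp. càdlàg paths vanishing at $0$, with the Skorokhod topology). For $t\in[0,\infty]$ let $\Omega_t$ be the corresponding space of paths restricted to $[0,t]$ (continuous case; to $[0,\infty)$ if $t=\infty$) or to $[0,t)$ (càdlàg cases). For $t<\infty$, the càdlàg spaces on $[0,t)$ carry the Skorokhod topology uniform on compact subsets of $[0,t)$: $x_n\to x$ iff there are increasing bijections $\gamma_n$ of $[0,t)$ with $\sup_u|\gamma_n(u)-u|\to0$ and $x_n\circ\gamma_n\to x$ uniformly on compact subsets of $[0,t)$. Let $\Pi_t:\Omega\to\Omega_t$ be the restriction map, identify $\mathcal C_b(\Omega_t)$ with $\{g\circ\Pi_t\}\subset\mathcal C_b(\Omega)$, and let $(\mathcal F_t)_{t\ge 0}$ be the (non-completed) right-continuous filtration generated by the open sets of the $\Omega_t$; put $\mathcal F_\infty=\mathcal B(\Omega)$. Let $\mathcal C$ be a convex, weakly compact set of Borel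 probability measures on $\Omega$ which is stable: for all $Q,Q'\in\mathcal C$ with $Q\ll Q'$ and every stopping time $\tau$ with values in $[0,\infty]$, the probability measure $R\ll Q'$ whose density process is the stopped density process of $Q$, $(dR/dQ')_t=(dQ/dQ')_{t\wedge\tau}$, i.e. $dR/dQ'=E_{Q'}[dQ/dQ'\mid\mathcal F_\tau]$, belongs to $\mathcal C$. Put $\rho(X)=\sup_{Q\in\mathcal C}E_Q(-X)$ and $c_\rho(X)=\rho(-|X|)$ for $X\in\mathcal C_b(\Omega)$. Let $L^1(c_\rho)$ be the Banach space obtained by separation and completion of $\mathcal C_b(\Omega)$ for the seminorm $c_\rho$, ordered by the closure of the cone of nonnegative bounded continuous functions, and let $L^1_t(c_\rho)$ be the closure of $\mathcal C_b(\Omega_t)$ in $L^1(c_\rho)$. Let $P$ be a probability measure in $K_+$, the nonnegative part of the unit ball of the dual of $L^1(c_\rho)$ (so that $L^1(c_\rho)$ maps to $L^1(P)$), which belongs to the canonical $c_\rho$-class: for $X,Y\in L^1(c_\rho)$, $X=Y$ $P$-a.s. if and only if $X=Y$ in $L^1(c_\rho)$. Let $\mathcal S=\{Q\in\mathcal C: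 Q\ll P\}$ and suppose that $\mathcal S$ represents $\rho$ in the sense that $\rho(X)=\sup_{Q\in\mathcal S,\,Q\sim P}E_Q(-X)$ for all $X\in\mathcal C_b(\Omega)$ (as is the case for $P=\sum_n\alpha_nQ_n$ with $\alpha_n>0$, $\sum_n\alpha_n=1$ and $\{Q_n\}$ dense in $\mathcal C$). Assume that for every $s\in[0,\infty)$ there is a $c_\rho$-dense subset of $\mathcal C_b(\Omega)$ such that for each $X$ in it there is $\rho_s(X)\in L^1_s(c_\rho)$ with $$\rho_s(X)=\operatorname*{ess\,sup}_{Q\in\mathcal S,\ Q\sim P}E_Q(-X\mid\mathcal F_s)\quad P\text{-a.s.}\qquad(*)$$ Then there is a family of continuous maps $\rho_s:L^1(c_\rho)\to L^1_s(c_\rho)$, $s\in[0,\infty]$, satisfying $(*)$ for all $s<\infty$ and all $X\in\mathcal C_b(\Omega)$, through which $\rho$ factorizes through time on $L^1(c_\rho)$. That is, $(\rho_s)$ is a time consistent sublinear dynamic risk measure: each $\rho_s$ satisfies $\rho_s(X)\ge\rho_s(Y)$ whenever $X\le Y$; $\rho_s(X+Y)=\rho_s(X)-Y$ for $X\in L^1(c_\rho)$,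 $Y\in L^1_s(c_\rho)$; convexity, subadditivity, and $\rho_s(\lambda X)=\lambda\rho_s(X)$ for $\lambda\ge0$; and $$\rho_r(X)=\rho_r(-\rho_s(X))\quad\text{in }L^1(c_\rho),\qquad 0\le r\le s\le\infty,\ X\in L^1(c_\rho).$$ Moreover $\rho_s(fX)\le f\rho_s(X)$ for all $0\le f\in\mathcal C_b(\Omega_s)$, $X\in L^1(c_\rho)$, and $\rho_0(X)=\rho(X)$ for all $X\in\mathcal C_b(\Omega)$. -/

import Mathlib

open MeasureTheory Set Filter Topology
open scoped NNReal ENNReal BoundedContinuousFunction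

noncomputable section

/-! ## Path spaces

The time axis is `[0, ∞) = ℝ≥0`; a horizon is an element `t` of `[0, ∞] = ℝ≥0∞`. -/

/-- The half-open interval `[0, t)`, for `t ∈ [0, ∞]`. -/
abbrev HalfOpen (t : ℝ≥0∞) : Type := {u : ℝ≥0 // (u : ℝ≥0∞) < t}

/-- The interval `[0, t]` for `t < ∞`, and `[0, ∞)` for `t = ∞`. -/
abbrev ClosedTo (t : ℝ≥0∞) : Type := {u : ℝ≥0 // (u : ℝ≥0∞) ≤ t}

/-- `C₀([0, t], ℝᵈ)` (`C₀([0, ∞), ℝᵈ)` for `t = ∞`): continuous functions vanishing at `0`, with the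
topology of uniform convergence on compact sets (the compact-open topology). -/
def ContPath (d : ℕ) (t : ℝ≥0∞) : Type :=
  {x : C(ClosedTo t, EuclideanSpace ℝ (Fin d)) // x ⟨0, by simp⟩ = 0}

instance (d : ℕ) (t : ℝ≥0∞) : TopologicalSpace (ContPath d t) :=
  inferInstanceAs (TopologicalSpace {x : C(ClosedTo t, EuclideanSpace ℝ (Fin d)) // x ⟨0, by simp⟩ = 0})

/-- `D([0, t), ℝᵈ)`: right-continuous functions with left limits. -/
def CadlagPath (d : ℕ) (t : ℝ≥0∞) : Type :=
  {x : HalfOpen t → EuclideanSpace ℝ (Fin d) //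
    ∀ u, Tendsto x (𝓝[>] u) (𝓝 (x u)) ∧ ∃ l, Tendsto x (𝓝[<] u) (𝓝 l)}

/-- Basic neighbourhoods of the Skorokhod topology: `y` is in the `(K, ε)`-neighbourhood of `x` if some
increasing bijection `γ` of `[0, t)` satisfies `|γ(u) - u| < ε` for all `u` and
`‖y(γ(u)) - x(u)‖ < ε` for all `u ∈ K`. -/
def skorokhodNhd {d : ℕ} {t : ℝ≥0∞} (x : CadlagPath d t) (K : Set (HalfOpen t)) (ε : ℝ) :
    Set (CadlagPath d t) :=
  {y | ∃ γ : HalfOpen t ≃o HalfOpen t, (∀ u, dist (γ u) u < ε) ∧ ∀ u ∈ K, dist (y.1 (γ u)) (x.1 u) < ε}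

/-- The Skorokhod topology on `D([0, ∞), ℝᵈ)` and, for `t < ∞`, the "uniform Skorokhod topology on
compact sets" on `D([0, t), ℝᵈ)`. It is the topology in which `xₙ → x` iff there are increasing bijections
`γₙ` of `[0, t)` with `sup_u |γₙ(u) - u| → 0` and `xₙ ∘ γₙ → x` uniformly on the compact subsets of
`[0, t)`. -/
instance (d : ℕ) (t : ℝ≥0∞) : TopologicalSpace (CadlagPath d t) where
  IsOpen U := ∀ x ∈ U, ∃ K : Set (HalfOpen t), IsCompact K ∧ ∃ ε > 0, skorokhodNhd x K ε ⊆ U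
  isOpen_univ := fun _ _ => ⟨∅, isCompact_empty, 1, one_pos, subset_univ _⟩
  isOpen_inter := by
    rintro U V hU hV x ⟨hxU, hxV⟩
    obtain ⟨K, hK, ε, hε, h⟩ := hU x hxU
    obtain ⟨K', hK', ε', hε', h'⟩ := hV x hxV
    refine ⟨K ∪ K', hK.union hK', min ε ε', lt_min hε hε', ?_⟩
    rintro y ⟨γ, h1, h2⟩
    exact ⟨h ⟨γ, fun u => (h1 u).trans_le (min_le_left _ _),
        fun u hu => (h2 u (Or.inl hu)).trans_le (min_le_left _ _)⟩,
      h' ⟨γ, fun u => (h1 u).trans_le (min_le_right _ _),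
        fun u hu => (h2 u (Or.inr hu)).trans_le (min_le_right _ _)⟩⟩
  isOpen_sUnion := by
    rintro S hS x ⟨U, hU, hx⟩
    obtain ⟨K, hK, ε, hε, h⟩ := hS U hU x hx
    exact ⟨K, hK, ε, hε, h.trans (subset_sUnion_of_mem hU)⟩

/-- `D₀([0, t), ℝᵈ)`: the càdlàg functions vanishing at `0`. -/
def CadlagPathZero (d : ℕ) (t : ℝ≥0∞) : Type :=
  {x : CadlagPath d t // ∀ u : HalfOpen t, u.1 = 0 → x.1 u = 0}

instance (d : ℕ) (t : ℝ≥0∞) : TopologicalSpace (CadlagPathZero d t) :=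
  inferInstanceAs (TopologicalSpace {x : CadlagPath d t // ∀ u : HalfOpen t, u.1 = 0 → x.1 u = 0})

/-- Restriction of a continuous path to a shorter horizon. -/
def ContPath.restrict {d : ℕ} {s t : ℝ≥0∞} (h : s ≤ t) (x : ContPath d t) : ContPath d s :=
  ⟨x.1.comp ⟨fun u => ⟨u.1, u.2.trans h⟩, by fun_prop⟩, x.2⟩

lemma ContPath.continuous_restrict {d : ℕ} {s t : ℝ≥0∞} (h : s ≤ t) :
    Continuous (ContPath.restrict (d := d) h) :=
  Continuous.subtype_mk ((ContinuousMap.continuous_precomp _).comp continuous_subtype_val) _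

/-- The inclusion `[0, s) ⊆ [0, t)`. -/
def HalfOpen.incl {s t : ℝ≥0∞} (h : s ≤ t) (u : HalfOpen s) : HalfOpen t := ⟨u.1, u.2.trans_le h⟩

lemma HalfOpen.continuous_incl {s t : ℝ≥0∞} (h : s ≤ t) : Continuous (HalfOpen.incl h) := by
  unfold HalfOpen.incl; fun_prop

/-- Restriction of a càdlàg path to a shorter horizon. -/
def CadlagPath.restrict {d : ℕ} {s t : ℝ≥0∞} (h : s ≤ t) (x : CadlagPath d t) : CadlagPath d s :=
  ⟨fun u => x.1 (HalfOpen.incl h u), fun u => by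
    have hc := (HalfOpen.continuous_incl h).continuousAt (x := u)
    refine ⟨(x.2 (HalfOpen.incl h u)).1.comp
      (tendsto_nhdsWithin_iff.2 ⟨hc.tendsto.mono_left nhdsWithin_le_nhds, ?_⟩), ?_⟩
    · filter_upwards [self_mem_nhdsWithin] with v hv using hv
    · obtain ⟨l, hl⟩ := (x.2 (HalfOpen.incl h u)).2
      refine ⟨l, hl.comp
        (tendsto_nhdsWithin_iff.2 ⟨hc.tendsto.mono_left nhdsWithin_le_nhds, ?_⟩)⟩
      filter_upwards [self_mem_nhdsWithin] with v hv using hv⟩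

/-- An increasing bijection of `[0, t)` that is uniformly close to the identity can be replaced, without
changing it on `[0, b]`, by one of `[0, s)`, where `b < s ≤ t`. -/
lemma HalfOpen.exists_orderIso {s t : ℝ≥0∞} (h : s ≤ t) (hs : s ≠ ⊤) (b : HalfOpen s) {ε : ℝ}
    (hε : ε < (s.toNNReal : ℝ) - b.1) (γ : HalfOpen t ≃o HalfOpen t) (hγ : ∀ u, dist (γ u) u < ε) :
    ∃ γ' : HalfOpen s ≃o HalfOpen s, (∀ u, dist (γ' u) u < ε) ∧
      ∀ u ≤ b, (HalfOpen.incl h (γ' u)) = γ (HalfOpen.incl h u) := by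
  -- work with real numbers: `S = s`, `B = b`, `L = γ b`
  obtain ⟨S, rfl⟩ : ∃ S : ℝ≥0, s = S := ⟨s.toNNReal, (ENNReal.coe_toNNReal hs).symm⟩
  simp only [ENNReal.toNNReal_coe] at hε
  set b' : HalfOpen t := HalfOpen.incl h b with hb'
  set L : ℝ≥0 := (γ b').1 with hL
  have hLb : |(L : ℝ) - b.1| < ε := by
    have := hγ b'
    rwa [Subtype.dist_eq, NNReal.dist_eq] at this
  have hLS : (L : ℝ) < S := by linarith [(abs_lt.1 hLb).2]
  have hbS : (b.1 : ℝ) < S := by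
    have := b.2
    exact_mod_cast this
  have hpos : (0 : ℝ) < S - b.1 := by linarith
  have hLpos : (0 : ℝ) < S - L := by linarith
  -- the affine part on `[b, s)`
  let A : ℝ → ℝ := fun u => S - (S - u) * ((S - L) / (S - b.1))
  have hq : (0 : ℝ) < (S - L) / (S - b.1) := div_pos hLpos hpos
  have hA0 : A b.1 = L := by
    simp only [A]; field_simp; ring
  have hAmono : StrictMono A := by
    intro u v huv
    simp only [A]; nlinarith
  have hAS : ∀ u < (S : ℝ), A u < S := by
    intro u hu
    simp only [A]; nlinarith
  have hAclose : ∀ u, (b.1 : ℝ) ≤ u → u < S → |A u - u| < ε := by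
    intro u hu huS
    have e : A u - u = ((S - u) / (S - b.1)) * (L - b.1) := by
      simp only [A]; field_simp; ring
    have h0 : 0 ≤ (S - u) / (S - b.1) := div_nonneg (by linarith) hpos.le
    have h1 : (S - u) / (S - b.1) ≤ 1 := (div_le_one hpos).2 (by linarith)
    rw [e, abs_mul, abs_of_nonneg h0]
    nlinarith [abs_nonneg ((L : ℝ) - b.1)]
  have hmemS : ∀ v : ℝ≥0, (v : ℝ) < S → (v : ℝ≥0∞) < (S : ℝ≥0∞) := fun v hv => by
    exact_mod_cast hv
  have hltS : ∀ u : HalfOpen (S : ℝ≥0∞), (u.1 : ℝ) < S := fun u => by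
    have := u.2
    exact_mod_cast this
  have hγle : ∀ u : HalfOpen (S : ℝ≥0∞), u ≤ b → ((γ (HalfOpen.incl h u)).1 : ℝ) ≤ L := by
    intro u hu
    have : γ (HalfOpen.incl h u) ≤ γ b' := γ.monotone hu
    exact_mod_cast this
  have hAge : ∀ u : HalfOpen (S : ℝ≥0∞), ¬ u ≤ b → (L : ℝ) < A u.1 := by
    intro u hu
    rw [← hA0]
    apply hAmono
    exact_mod_cast not_le.1 hu
  let f : HalfOpen (S : ℝ≥0∞) → HalfOpen (S : ℝ≥0∞) := fun u =>
    if hu : u ≤ b then ⟨(γ (HalfOpen.incl h u)).1, hmemS _ ((hγle u hu).trans_lt hLS)⟩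
    else ⟨⟨A u.1, L.2.trans (hAge u hu).le⟩, hmemS _ (hAS _ (hltS u))⟩
  have hf1 : ∀ u, u ≤ b → ((f u).1 : ℝ) = (γ (HalfOpen.incl h u)).1 := by
    intro u hu; simp only [f, dif_pos hu]
  have hf2 : ∀ u, ¬ u ≤ b → ((f u).1 : ℝ) = A u.1 := by
    intro u hu; simp only [f, dif_neg hu]; rfl
  have hfmono : StrictMono f := by
    intro u v huv
    have huv' : (u.1 : ℝ) < v.1 := by exact_mod_cast huv
    suffices hh : ((f u).1 : ℝ) < (f v).1 by exact_mod_cast hh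
    by_cases hv : v ≤ b
    · rw [hf1 u (huv.le.trans hv), hf1 v hv]
      have : γ (HalfOpen.incl h u) < γ (HalfOpen.incl h v) := γ.strictMono huv
      exact_mod_cast this
    · by_cases hu : u ≤ b
      · rw [hf1 u hu, hf2 v hv]
        exact (hγle u hu).trans_lt (hAge v hv)
      · rw [hf2 u hu, hf2 v hv]
        exact hAmono huv'
  have hfsurj : Function.Surjective f := by
    intro v
    by_cases hv : (v.1 : ℝ) ≤ L
    · have hvt : (v.1 : ℝ≥0∞) < t := v.2.trans_le h
      set w : HalfOpen t := γ.symm ⟨v.1, hvt⟩ with hw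
      have hwb : w ≤ b' := by
        rw [hw, OrderIso.symm_apply_le]
        have : v.1 ≤ L := by exact_mod_cast hv
        exact this
      have hwb1 : w.1 ≤ b.1 := hwb
      refine ⟨⟨w.1, hmemS _ (lt_of_le_of_lt (by exact_mod_cast hwb1) hbS)⟩, ?_⟩
      apply Subtype.ext
      apply NNReal.coe_injective
      rw [hf1 _ hwb1]
      have : HalfOpen.incl h ⟨w.1, hmemS _ (lt_of_le_of_lt (by exact_mod_cast hwb1) hbS)⟩ = w := rfl
      rw [this, hw, OrderIso.apply_symm_apply]
    · have hv' : (L : ℝ) < v.1 := not_le.1 hv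
      set u : ℝ := S - (S - v.1) * ((S - b.1) / (S - L)) with hu
      have hAu : A u = v.1 := by
        simp only [A, hu]; field_simp; ring
      have hub : (b.1 : ℝ) < u := by
        apply hAmono.lt_iff_lt.1
        rw [hA0, hAu]; exact hv'
      have huS : u < S := by
        have : (0 : ℝ) < ((S : ℝ) - v.1) * (((S : ℝ) - b.1) / ((S : ℝ) - L)) :=
          mul_pos (by linarith [hltS v]) (div_pos hpos hLpos)
        rw [hu]; linarith
      refine ⟨⟨⟨u, b.1.2.trans hub.le⟩, hmemS _ huS⟩, ?_⟩
      apply Subtype.ext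
      apply NNReal.coe_injective
      rw [hf2 _ (fun hle => absurd hub (not_lt.2 (by exact_mod_cast hle)))]
      exact hAu
  refine ⟨hfmono.orderIsoOfSurjective f hfsurj, fun u => ?_, fun u hu => ?_⟩
  · change dist (f u) u < ε
    rw [Subtype.dist_eq, NNReal.dist_eq]
    by_cases hu : u ≤ b
    · rw [hf1 u hu]
      have := hγ (HalfOpen.incl h u)
      rwa [Subtype.dist_eq, NNReal.dist_eq] at this
    · rw [hf2 u hu]
      exact hAclose _ (by exact_mod_cast (not_le.1 hu).le) (hltS u)
  · apply Subtype.ext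
    apply NNReal.coe_injective
    exact hf1 u hu

lemma CadlagPath.continuous_restrict {d : ℕ} {s t : ℝ≥0∞} (h : s ≤ t) :
    Continuous (CadlagPath.restrict (d := d) h) := by
  refine ⟨fun U hU x hx => ?_⟩
  obtain ⟨K, hK, ε, hε, hsub⟩ := hU _ hx
  rcases eq_or_ne s ⊤ with rfl | hs
  · obtain rfl : t = ⊤ := top_le_iff.1 h
    exact ⟨K, hK, ε, hε, hsub⟩
  rcases K.eq_empty_or_nonempty with rfl | hne
  · exact ⟨∅, isCompact_empty, ε, hε, fun y _ =>
      hsub ⟨OrderIso.refl _, fun u => by simpa using hε, fun u hu => hu.elim⟩⟩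
  obtain ⟨b, -, hb⟩ := hK.exists_isGreatest hne
  have hbs : (0 : ℝ) < (s.toNNReal : ℝ) - b.1 := by
    have h1 : b.1 < s.toNNReal := by
      rw [← ENNReal.coe_lt_coe, ENNReal.coe_toNNReal hs]
      exact b.2
    exact sub_pos.2 (by exact_mod_cast h1)
  obtain ⟨δ, hδ0, hδ⟩ := exists_between (lt_min hε hbs)
  refine ⟨HalfOpen.incl h '' K, hK.image (HalfOpen.continuous_incl h), δ, hδ0, ?_⟩
  rintro y ⟨γ, h1, h2⟩
  obtain ⟨γ', h1', h2'⟩ := HalfOpen.exists_orderIso h hs b (hδ.trans_le (min_le_right _ _)) γ h1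
  have hδε : δ < ε := hδ.trans_le (min_le_left _ _)
  refine hsub ⟨γ', fun u => (h1' u).trans hδε, fun u hu => ?_⟩
  have := h2 _ (mem_image_of_mem _ hu)
  rw [← h2' u (hb hu)] at this
  exact this.trans hδε

/-- Restriction of a càdlàg path vanishing at `0` to a shorter horizon. -/
def CadlagPathZero.restrict {d : ℕ} {s t : ℝ≥0∞} (h : s ≤ t) (x : CadlagPathZero d t) :
    CadlagPathZero d s :=
  ⟨x.1.restrict h, fun u hu => x.2 (HalfOpen.incl h u) hu⟩

lemma CadlagPathZero.continuous_restrict {d : ℕ} {s t : ℝ≥0∞} (h : s ≤ t) :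
    Continuous (CadlagPathZero.restrict (d := d) h) :=
  Continuous.subtype_mk ((CadlagPath.continuous_restrict h).comp continuous_subtype_val) _

/-- The three kinds of path spaces: `C₀`, `D` and `D₀`. -/
inductive PathKind
  | cont
  | cadlag
  | cadlagZero

/-- The path space `Ωₜ`, `t ∈ [0, ∞]`: `C₀([0, t], ℝᵈ)`, `D([0, t), ℝᵈ)` or `D₀([0, t), ℝᵈ)`. -/
def PathsTo (k : PathKind) (d : ℕ) (t : ℝ≥0∞) : Type :=
  match k with
  | .cont => ContPath d t
  | .cadlag => CadlagPath d t
  | .cadlagZero => CadlagPathZero d t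

instance (k : PathKind) (d : ℕ) (t : ℝ≥0∞) : TopologicalSpace (PathsTo k d t) :=
  match k with
  | .cont => inferInstanceAs (TopologicalSpace (ContPath d t))
  | .cadlag => inferInstanceAs (TopologicalSpace (CadlagPath d t))
  | .cadlagZero => inferInstanceAs (TopologicalSpace (CadlagPathZero d t))

instance (k : PathKind) (d : ℕ) (t : ℝ≥0∞) : MeasurableSpace (PathsTo k d t) := borel _

instance (k : PathKind) (d : ℕ) (t : ℝ≥0∞) : BorelSpace (PathsTo k d t) := ⟨rfl⟩

/-- The projection `Ωₜ → Ωₛ`, `x ↦ x|_{[0,s]}` (resp. `x|_{[0,s)}`), for `s ≤ t`. -/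
def PathsTo.restrict {k : PathKind} {d : ℕ} {s t : ℝ≥0∞} (h : s ≤ t) :
    PathsTo k d t → PathsTo k d s :=
  match k with
  | .cont => ContPath.restrict h
  | .cadlag => CadlagPath.restrict h
  | .cadlagZero => CadlagPathZero.restrict h

lemma PathsTo.continuous_restrict {k : PathKind} {d : ℕ} {s t : ℝ≥0∞} (h : s ≤ t) :
    Continuous (PathsTo.restrict (k := k) (d := d) h) :=
  match k with
  | .cont => ContPath.continuous_restrict h
  | .cadlag => CadlagPath.continuous_restrict h
  | .cadlagZero => CadlagPathZero.continuous_restrict h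

lemma PathsTo.restrict_restrict {k : PathKind} {d : ℕ} {r s t : ℝ≥0∞} (h : r ≤ s) (h' : s ≤ t)
    (x : PathsTo k d t) : (x.restrict h').restrict h = x.restrict (h.trans h') := by
  cases k <;> rfl

/-- The canonical space `Ω = Ω_∞`. -/
abbrev Paths (k : PathKind) (d : ℕ) : Type := PathsTo k d ⊤

/-- The projection `Πₜ : Ω → Ωₜ`. -/
abbrev Paths.proj {k : PathKind} {d : ℕ} (t : ℝ≥0∞) : Paths k d → PathsTo k d t :=
  PathsTo.restrict le_top

/-- The filtration generated by the open sets of `Ωₜ`. -/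
def rawFiltration (k : PathKind) (d : ℕ) :
    Filtration ℝ≥0 (inferInstance : MeasurableSpace (Paths k d)) where
  seq t := MeasurableSpace.comap (Paths.proj (t : ℝ≥0∞)) inferInstance
  mono' := by
    intro s t hst
    have h : (s : ℝ≥0∞) ≤ t := by exact_mod_cast hst
    have : (Paths.proj (s : ℝ≥0∞) : Paths k d → _) = PathsTo.restrict h ∘ Paths.proj (t : ℝ≥0∞) := by
      funext x; exact (PathsTo.restrict_restrict h le_top x).symm
    change MeasurableSpace.comap _ _ ≤ _
    rw [this, ← MeasurableSpace.comap_comp]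
    exact MeasurableSpace.comap_mono (PathsTo.continuous_restrict h).measurable.comap_le
  le' t := (PathsTo.continuous_restrict le_top).measurable.comap_le

/-- The right-continuous filtration `(ℬₜ)` generated by the open sets of `Ωₜ` (not completed). -/
def pathFiltration (k : PathKind) (d : ℕ) :
    Filtration ℝ≥0 (inferInstance : MeasurableSpace (Paths k d)) :=
  (rawFiltration k d).rightCont

/-! ## The risk measure, its capacity, and the Banach space `L¹(c)` -/

section Capacity

variable {Ω : Type} [TopologicalSpace Ω] [MeasurableSpace Ω] [BorelSpace Ω]

/-- `ρ(f) = sup_{Q ∈ 𝒞} E_Q(-f)` for bounded continuous `f`. -/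
def riskOf (C : Set (ProbabilityMeasure Ω)) (f : Ω →ᵇ ℝ) : ℝ :=
  ⨆ Q : C, ∫ ω, -f ω ∂(Q : Measure Ω)

/-- The capacity `c_ρ(f) = ρ(-|f|)`. -/
def capacity (C : Set (ProbabilityMeasure Ω)) (f : Ω →ᵇ ℝ) : ℝ := riskOf C (-|f|)

lemma capacity_eq (C : Set (ProbabilityMeasure Ω)) (f : Ω →ᵇ ℝ) :
    capacity C f = ⨆ Q : C, ∫ ω, |f ω| ∂(Q : Measure Ω) := by
  simp [capacity, riskOf]

lemma integral_abs_le (Q : ProbabilityMeasure Ω) (f : Ω →ᵇ ℝ) :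
    ∫ ω, |f ω| ∂(Q : Measure Ω) ≤ ‖f‖ := by
  calc ∫ ω, |f ω| ∂(Q : Measure Ω) ≤ ∫ _, ‖f‖ ∂(Q : Measure Ω) :=
        integral_mono (f.integrable _).abs (integrable_const _) fun ω => f.norm_coe_le_norm ω
    _ = ‖f‖ := by simp

lemma integral_abs_le_capacity {C : Set (ProbabilityMeasure Ω)} (Q : C) (f : Ω →ᵇ ℝ) :
    ∫ ω, |f ω| ∂(Q : Measure Ω) ≤ capacity C f := by
  rw [capacity_eq]
  exact le_ciSup (f := fun Q : C => ∫ ω, |f ω| ∂(Q : Measure Ω))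
    ⟨‖f‖, by rintro _ ⟨Q, rfl⟩; exact integral_abs_le _ f⟩ Q

lemma capacity_le {C : Set (ProbabilityMeasure Ω)} {f : Ω →ᵇ ℝ} {a : ℝ} (ha : 0 ≤ a)
    (h : ∀ Q : C, ∫ ω, |f ω| ∂(Q : Measure Ω) ≤ a) : capacity C f ≤ a := by
  rw [capacity_eq]
  exact Real.iSup_le h ha

lemma capacity_nonneg (C : Set (ProbabilityMeasure Ω)) (f : Ω →ᵇ ℝ) : 0 ≤ capacity C f := by
  rw [capacity_eq]
  exact Real.iSup_nonneg fun Q => integral_nonneg fun _ => abs_nonneg _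

/-- The capacity as a seminorm on `C_b(Ω)`. -/
def capacitySeminorm (C : Set (ProbabilityMeasure Ω)) : Seminorm ℝ (Ω →ᵇ ℝ) :=
  Seminorm.of (capacity C)
    (fun f g => capacity_le (add_nonneg (capacity_nonneg C f) (capacity_nonneg C g)) fun Q => by
      calc ∫ ω, |(f + g) ω| ∂(Q : Measure Ω)
          ≤ ∫ ω, (|f ω| + |g ω|) ∂(Q : Measure Ω) :=
            integral_mono ((f + g).integrable _).abs ((f.integrable _).abs.add (g.integrable _).abs)
              fun ω => abs_add_le _ _
        _ = ∫ ω, |f ω| ∂(Q : Measure Ω) + ∫ ω, |g ω| ∂(Q : Measure Ω) :=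
            integral_add (f.integrable _).abs (g.integrable _).abs
        _ ≤ _ := add_le_add (integral_abs_le_capacity Q f) (integral_abs_le_capacity Q g))
    (fun a f => by
      simp only [capacity_eq, BoundedContinuousFunction.coe_smul, smul_eq_mul, abs_mul,
        integral_const_mul, Real.norm_eq_abs]
      exact (Real.mul_iSup_of_nonneg (abs_nonneg a) _).symm)

/-- `C_b(Ω)` endowed with the seminorm `c_ρ`. -/
def Cb (C : Set (ProbabilityMeasure Ω)) : Type := Ω →ᵇ ℝ

instance (C : Set (ProbabilityMeasure Ω)) : AddCommGroup (Cb C) :=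
  inferInstanceAs (AddCommGroup (Ω →ᵇ ℝ))

instance (C : Set (ProbabilityMeasure Ω)) : Module ℝ (Cb C) :=
  inferInstanceAs (Module ℝ (Ω →ᵇ ℝ))

instance (C : Set (ProbabilityMeasure Ω)) : SeminormedAddCommGroup (Cb C) :=
  AddGroupSeminorm.toSeminormedAddCommGroup (capacitySeminorm C).toAddGroupSeminorm

instance (C : Set (ProbabilityMeasure Ω)) : NormedSpace ℝ (Cb C) where
  norm_smul_le a f := le_of_eq (map_smul_eq_mul (capacitySeminorm C) a f)

/-- A bounded continuous function as an element of the seminormed space `(C_b(Ω), c_ρ)`. -/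
def toCb (C : Set (ProbabilityMeasure Ω)) (f : Ω →ᵇ ℝ) : Cb C := f

/-- The bounded continuous function underlying an element of `(C_b(Ω), c_ρ)`. -/
def Cb.fn {C : Set (ProbabilityMeasure Ω)} (f : Cb C) : Ω →ᵇ ℝ := f

/-- The Banach space `L¹(c_ρ)`: the (separated) completion of `C_b(Ω)` with respect to `c_ρ`. -/
abbrev L1c (C : Set (ProbabilityMeasure Ω)) : Type := UniformSpace.Completion (Cb C)

/-- The canonical map `C_b(Ω) → L¹(c_ρ)`. -/
def toL1c (C : Set (ProbabilityMeasure Ω)) : (Ω →ᵇ ℝ) →ₗ[ℝ] L1c C where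
  toFun f := ((toCb C f : Cb C) : L1c C)
  map_add' f g := UniformSpace.Completion.coe_add (toCb C f) (toCb C g)
  map_smul' a f := UniformSpace.Completion.coe_smul a (toCb C f)

/-- The order of `L¹(c_ρ)`: `X ≤ Y` iff `Y - X` is a limit of nonnegative bounded continuous functions. -/
def L1c.Le {C : Set (ProbabilityMeasure Ω)} (X Y : L1c C) : Prop :=
  Y - X ∈ closure (toL1c C '' {f | 0 ≤ f})

/-- Multiplication by a bounded continuous function, on `(C_b(Ω), c_ρ)`. -/
def Cb.mul {C : Set (ProbabilityMeasure Ω)} (f : Ω →ᵇ ℝ) (g : Cb C) : Cb C := toCb C (f * g.fn)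

lemma Cb.uniformContinuous_mul {C : Set (ProbabilityMeasure Ω)} (f : Ω →ᵇ ℝ) :
    UniformContinuous (Cb.mul (C := C) f) := by
  refine (LipschitzWith.of_dist_le_mul (K := ‖f‖₊) fun g g' => ?_).uniformContinuous
  rw [dist_eq_norm, dist_eq_norm]
  have e : Cb.mul f g - Cb.mul f g' = toCb C (f * (g - g').fn) := by
    change f * g.fn - f * g'.fn = f * (g.fn - g'.fn)
    ring
  rw [e]
  change capacity C (f * (g - g').fn) ≤ ‖f‖ * capacity C (g - g').fn
  refine capacity_le (mul_nonneg (norm_nonneg _) (capacity_nonneg _ _)) fun Q => ?_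
  calc ∫ ω, |(f * (g - g').fn) ω| ∂(Q : Measure Ω)
      ≤ ∫ ω, ‖f‖ * |(g - g').fn ω| ∂(Q : Measure Ω) :=
        integral_mono ((f * (g - g').fn).integrable _).abs (((g - g').fn.integrable _).abs.const_mul _)
          fun ω => by
            change |f ω * (g - g').fn ω| ≤ _
            rw [abs_mul]
            exact mul_le_mul_of_nonneg_right (f.norm_coe_le_norm ω) (abs_nonneg _)
    _ = ‖f‖ * ∫ ω, |(g - g').fn ω| ∂(Q : Measure Ω) := integral_const_mul _ _
    _ ≤ _ := mul_le_mul_of_nonneg_left (integral_abs_le_capacity Q _) (norm_nonneg _)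

/-- The product `f X` of `X ∈ L¹(c_ρ)` with a bounded continuous function `f`: the continuous extension
of `g ↦ f g` (which satisfies `c_ρ(f g) ≤ ‖f‖_∞ c_ρ(g)`). -/
def L1c.mul {C : Set (ProbabilityMeasure Ω)} (f : Ω →ᵇ ℝ) : L1c C → L1c C :=
  UniformSpace.Completion.map (Cb.mul f)

/-- `X ∈ L¹(c_ρ)` equals the random variable `g` `P`-almost surely: `X` is a `c_ρ`-limit of bounded
continuous functions which converge to `g` in `L¹(P)`. For `P` in the unit ball of the dual of `L¹(c_ρ)`
this says that `g` is a version of the image of `X` under the continuous map `L¹(c_ρ) → L¹(P)` that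
extends the identity of `C_b(Ω)`. -/
def L1c.EqAS {C : Set (ProbabilityMeasure Ω)} (P : ProbabilityMeasure Ω) (X : L1c C) (g : Ω → ℝ) :
    Prop :=
  Integrable g (P : Measure Ω) ∧
    ∀ ε > 0, ∃ f : Ω →ᵇ ℝ, ‖X - toL1c C f‖ < ε ∧ ∫ ω, |f ω - g ω| ∂(P : Measure Ω) < ε

/-- `P` (as a linear form) is in `K₊`, the nonnegative part of the unit ball of the dual of `L¹(c_ρ)`. -/
def InUnitBallDual (C : Set (ProbabilityMeasure Ω)) (P : ProbabilityMeasure Ω) : Prop :=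
  ∀ f : Ω →ᵇ ℝ, |∫ ω, f ω ∂(P : Measure Ω)| ≤ capacity C f

/-- `P` belongs to the canonical `c_ρ`-class: it is in `K₊`, and for `X, Y ∈ L¹(c_ρ)`, `X = Y` `P`-a.s.
if and only if `X = Y` in `L¹(c_ρ)`. -/
def InCanonicalClass (C : Set (ProbabilityMeasure Ω)) (P : ProbabilityMeasure Ω) : Prop :=
  InUnitBallDual C P ∧
    ∀ X Y : L1c C, (∃ g : Ω → ℝ, X.EqAS P g ∧ Y.EqAS P g) ↔ X = Y

/-- Convexity of a set of probability measures. -/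
def IsConvexSet (C : Set (ProbabilityMeasure Ω)) : Prop :=
  ∀ P ∈ C, ∀ Q ∈ C, ∀ a b : ℝ≥0, a + b = 1 →
    ∃ R ∈ C, (R : Measure Ω) = a • (P : Measure Ω) + b • (Q : Measure Ω)

/-- The `σ`-algebra `ℱ_τ` of a stopping time `τ` with values in `[0, ∞]` (with `ℱ_∞ = ℬ(Ω)`). -/
@[reducible] def stoppedSigma (F : Filtration ℝ≥0 (inferInstance : MeasurableSpace Ω))
    {τ : Ω → WithTop ℝ≥0} (hτ : IsStoppingTime F τ) : MeasurableSpace Ω where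
  MeasurableSet' A := MeasurableSet A ∧ ∀ t : ℝ≥0, MeasurableSet[F t] (A ∩ {ω | τ ω ≤ t})
  measurableSet_empty := by simp
  measurableSet_compl A hA := by
    refine ⟨hA.1.compl, fun t => ?_⟩
    have : Aᶜ ∩ {ω | τ ω ≤ t} = {ω | τ ω ≤ t} \ (A ∩ {ω | τ ω ≤ t}) := by
      ext ω; simp; tauto
    rw [this]
    exact (hτ t).diff (hA.2 t)
  measurableSet_iUnion A hA := by
    refine ⟨MeasurableSet.iUnion fun i => (hA i).1, fun t => ?_⟩
    rw [iUnion_inter]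
    exact MeasurableSet.iUnion fun i => (hA i).2 t

/-- Stability: for `P, Q ∈ 𝒞` with `Q ≪ P` and every stopping time `τ`, there is `R ∈ 𝒞`, `R ≪ P`, whose
density process with respect to `P` is the density process of `Q` stopped at `τ`. Here the density process
of `Q` is `(dQ/dP)_t = E_P(dQ/dP | ℱ_t)`, `t ∈ [0, ∞]`, its value at the stopping time `τ` is
`E_P(dQ/dP | ℱ_τ)`, and `R` has the stopped process as density process iff
`dR/dP = (dQ/dP)_τ` `P`-a.s. -/
def IsStable (F : Filtration ℝ≥0 (inferInstance : MeasurableSpace Ω))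
    (C : Set (ProbabilityMeasure Ω)) : Prop :=
  ∀ P ∈ C, ∀ Q ∈ C, (Q : Measure Ω) ≪ (P : Measure Ω) →
    ∀ (τ : Ω → WithTop ℝ≥0) (hτ : IsStoppingTime F τ),
      ∃ R ∈ C, (R : Measure Ω) ≪ (P : Measure Ω) ∧
        (fun ω => ((R : Measure Ω).rnDeriv P ω).toReal) =ᵐ[(P : Measure Ω)]
          (P : Measure Ω)[fun ω => ((Q : Measure Ω).rnDeriv P ω).toReal | stoppedSigma F hτ]

/-- `g` is the `P`-essential supremum of the family `Φ` of random variables. -/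
def IsEssSup (P : ProbabilityMeasure Ω) (Φ : Set (Ω → ℝ)) (g : Ω → ℝ) : Prop :=
  AEMeasurable g (P : Measure Ω) ∧ (∀ φ ∈ Φ, φ ≤ᵐ[(P : Measure Ω)] g) ∧
    ∀ h : Ω → ℝ, AEMeasurable h (P : Measure Ω) → (∀ φ ∈ Φ, φ ≤ᵐ[(P : Measure Ω)] h) →
      g ≤ᵐ[(P : Measure Ω)] h

/-- `𝒮 = 𝒞 ∩ {Q ≪ P}`. -/
def dominated (C : Set (ProbabilityMeasure Ω)) (P : ProbabilityMeasure Ω) :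
    Set (ProbabilityMeasure Ω) :=
  {Q ∈ C | (Q : Measure Ω) ≪ (P : Measure Ω)}

/-- `{Q ∈ 𝒮 | Q ∼ P}`. -/
def equivalents (C : Set (ProbabilityMeasure Ω)) (P : ProbabilityMeasure Ω) :
    Set (ProbabilityMeasure Ω) :=
  {Q ∈ dominated C P | (P : Measure Ω) ≪ (Q : Measure Ω)}

/-- `Z ∈ L¹(c_ρ)` satisfies `Z = ess sup_{Q ∈ 𝒮, Q ∼ P} E_Q(-X | ℱ_s)` `P`-a.s. -/
def IsConditionalRisk (F : Filtration ℝ≥0 (inferInstance : MeasurableSpace Ω))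
    (C : Set (ProbabilityMeasure Ω)) (P : ProbabilityMeasure Ω) (s : ℝ≥0) (X : Ω →ᵇ ℝ) (Z : L1c C) :
    Prop :=
  ∃ g : Ω → ℝ, Z.EqAS P g ∧
    IsEssSup P {φ | ∃ Q ∈ equivalents C P, φ = (Q : Measure Ω)[fun ω => -X ω | F s]} g

end Capacity

/-! ## Dynamic risk measures on `L¹(c_ρ)` -/

section Dynamic

variable {k : PathKind} {d : ℕ}

/-- The embedding `C_b(Ωₜ) ⊆ C_b(Ω)`, `g ↦ g ∘ Πₜ`. -/
def cylinder (t : ℝ≥0∞) : (PathsTo k d t →ᵇ ℝ) →ₗ[ℝ] (Paths k d →ᵇ ℝ) where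
  toFun g := g.compContinuous ⟨Paths.proj t, PathsTo.continuous_restrict le_top⟩
  map_add' _ _ := rfl
  map_smul' _ _ := rfl

/-- `L¹ₜ(c_ρ)`: the closure of `C_b(Ωₜ)` in `L¹(c_ρ)`. -/
def L1cTo (C : Set (ProbabilityMeasure (Paths k d))) (t : ℝ≥0∞) : Submodule ℝ (L1c C) :=
  (LinearMap.range (toL1c C ∘ₗ cylinder t)).topologicalClosure

/-- A time consistent sublinear dynamic risk measure on `L¹(c_ρ)`: a family of maps
`ρ_s : L¹(c_ρ) → L¹_s(c_ρ)`, `s ∈ [0, ∞]` (with `ρ_{s,t}` the restriction of `ρ_s` to `L¹ₜ(c_ρ)`). -/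
structure IsTimeConsistentSublinear (C : Set (ProbabilityMeasure (Paths k d)))
    (ρ : (s : ℝ≥0∞) → L1c C → L1cTo C s) : Prop where
  monotone : ∀ s X Y, L1c.Le X Y → L1c.Le (ρ s Y : L1c C) (ρ s X)
  translation : ∀ s X (Y : L1cTo C s), ρ s (X + Y) = ρ s X - Y
  convex : ∀ s X Y (a : ℝ), 0 ≤ a → a ≤ 1 →
    L1c.Le (ρ s (a • X + (1 - a) • Y) : L1c C) (a • ρ s X + (1 - a) • ρ s Y)
  subadditive : ∀ s X Y, L1c.Le (ρ s (X + Y) : L1c C) (ρ s X + ρ s Y)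
  homogeneous : ∀ s X (a : ℝ), 0 ≤ a → ρ s (a • X) = a • ρ s X
  timeConsistent : ∀ r s, r ≤ s → ∀ X, ρ r X = ρ r (-(ρ s X : L1c C))

/-- `ρ(f) = sup_{Q ∈ 𝒞} E_Q(-f)` factorizes through time on `L¹(c_ρ)` into the family `(ρ_s)`: the family
is a time consistent sublinear dynamic risk measure on `L¹(c_ρ)`, `ρ_s(f X) ≤ f ρ_s(X)` for all `X` and
all nonnegative `f ∈ C_b(Ω_s)`, and `ρ_0(X) = ρ(X)` for all `X ∈ C_b(Ω)`. -/
structure FactorizesInto (C : Set (ProbabilityMeasure (Paths k d)))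
    (ρ : (s : ℝ≥0∞) → L1c C → L1cTo C s) : Prop extends IsTimeConsistentSublinear C ρ where
  mul_le : ∀ s (f : PathsTo k d s →ᵇ ℝ), 0 ≤ f → ∀ X : L1c C,
    L1c.Le (ρ s (L1c.mul (cylinder s f) X) : L1c C) (L1c.mul (cylinder s f) (ρ s X))
  extends_risk : ∀ X : Paths k d →ᵇ ℝ,
    (ρ 0 (toL1c C X) : L1c C) = toL1c C (BoundedContinuousFunction.const _ (riskOf C X))

end Dynamic

end

/-! Everything rests on a description of the essential supremum that needs only integrals. For a
σ-algebra `m`, call `Z` a conditional risk of `X` (`CondRisk`) if `Z` is a limit of `m`-measurable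
bounded continuous functions, if `∫_A -X dQ ≤ ∫_A Z dQ` for all `Q ∼ P` in `C` and `A ∈ m`, and if
from every model `R ∼ P` in `C` some model `Q ∼ P` in `C` with the same law on `m` satisfies `E_R Z
≤ E_Q(-X) + ε`. All these integrals are norm continuous on `L¹(c_ρ)`, so the notion makes sense for
every `X` there and survives limits.

Such a `Z` is the least dominating adapted element (`CondRisk.le`), hence unique: the norm and the
order of adapted elements are determined by integrals over sets of `m`, because an approximant that
is continuous and `m`-measurable has its sign set in `m` and its capacity is a supremum over the
models equivalent to `P`. Monotonicity, translation, homogeneity, subadditivity and `ρ_s(fX) ≤ f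
ρ_s(X)` then reduce to checking a candidate. Time consistency is a chain of two approximations, from
`R` to `Q` with the same past up to `r`, then from `Q` to `Q'` with the same past up to `s`
(`CondRisk.trans`).

Stability enters twice. A constant stopping time lets the law of `R` up to `s` be continued by the
conditional law of `Q` (`IsStable.followsOn`). A time equal to `s` on `A` and to `∞` elsewhere
pastes two models with the same past (`IsStable.pastesOn`). Pasting directs the conditional losses
upwards and makes conditional risks contractions (`CondRisk.norm_sub_le`). Both constructions
together show that the essential supremum is a conditional risk (`condRisk_of_isEssSup`), and
contractivity carries existence from the given dense set to all of `L¹(c_ρ)`. At time `∞` the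
conditional risk is `-X`. At time `0` the space `Ω_0` is at most a point, so `ρ_0(X)` is a constant,
which must be `ρ(X)`. -/

noncomputable section

/-! ### Concatenating and pasting models by stability -/

section Pasting

variable {Ω : Type} {m m' : MeasurableSpace Ω} [mΩ : MeasurableSpace Ω]

variable (m) in
/-- The two probability measures agree on the `σ`-algebra `m`. -/
def AgreeOn (Q R : ProbabilityMeasure Ω) : Prop :=
  ∀ A, MeasurableSet[m] A → (Q : Measure Ω) A = (R : Measure Ω) A

lemma AgreeOn.symm {Q R : ProbabilityMeasure Ω} (h : AgreeOn m Q R) :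
    AgreeOn m R Q := fun A hA => (h A hA).symm

lemma AgreeOn.trans {Q R S : ProbabilityMeasure Ω} (h : AgreeOn m Q R)
    (h' : AgreeOn m R S) : AgreeOn m Q S := fun A hA => (h A hA).trans (h' A hA)

lemma AgreeOn.mono {Q R : ProbabilityMeasure Ω} (h : AgreeOn m Q R)
    (hm : m' ≤ m) : AgreeOn m' Q R := fun A hA => h A (hm A hA)

lemma AgreeOn.setIntegral_eq {Q R : ProbabilityMeasure Ω}
    (h : AgreeOn m Q R) (hm : m ≤ mΩ) {f : Ω → ℝ} (hf : StronglyMeasurable[m] f)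
    {A : Set Ω} (hA : MeasurableSet[m] A) :
    ∫ ω in A, f ω ∂(Q : Measure Ω) = ∫ ω in A, f ω ∂(R : Measure Ω) := by
  have e : (Q : Measure Ω).trim hm = (R : Measure Ω).trim hm := by
    refine @Measure.ext _ m _ _ fun B hB => ?_
    rw [trim_measurableSet_eq hm hB, trim_measurableSet_eq hm hB, h B hB]
  rw [setIntegral_trim hm hf hA, e, ← setIntegral_trim hm hf hA]

lemma AgreeOn.integral_eq {Q R : ProbabilityMeasure Ω}
    (h : AgreeOn m Q R) (hm : m ≤ mΩ) {f : Ω → ℝ} (hf : StronglyMeasurable[m] f) :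
    ∫ ω, f ω ∂(Q : Measure Ω) = ∫ ω, f ω ∂(R : Measure Ω) := by
  simpa using h.setIntegral_eq hm hf (@MeasurableSet.univ _ m)

variable (m) in
/-- `Q` and `Q'`, which agree on `m`, can be pasted along sets of `m` within `E`. -/
def PastesOn (E : Set (ProbabilityMeasure Ω)) : Prop :=
  ∀ Q ∈ E, ∀ Q' ∈ E, AgreeOn m Q Q' → ∀ A, MeasurableSet[m] A →
    ∃ R ∈ E, ∀ B, MeasurableSet B →
      (R : Measure Ω) B = (Q : Measure Ω) (B ∩ A) + (Q' : Measure Ω) (B ∩ Aᶜ)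

variable [TopologicalSpace Ω]

variable (m) in
/-- Every law `R` in `E` on `m` can be followed within `E` by the conditional law given `m` of any
`Q` in `E`. -/
def FollowsOn [BorelSpace Ω] (E : Set (ProbabilityMeasure Ω)) : Prop :=
  ∀ Q ∈ E, ∀ R ∈ E, ∃ Q' ∈ E, AgreeOn m Q' R ∧ ∀ f : Ω →ᵇ ℝ,
    (Q' : Measure Ω)[f | m] =ᵐ[(Q : Measure Ω)] (Q : Measure Ω)[f | m]

omit [TopologicalSpace Ω] in
lemma equivalents_ac {C : Set (ProbabilityMeasure Ω)} {P Q R : ProbabilityMeasure Ω}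
    (hQ : Q ∈ equivalents C P) (hR : R ∈ equivalents C P) : (Q : Measure Ω) ≪ (R : Measure Ω) :=
  hQ.1.2.trans hR.2

lemma stoppedSigma_le (F : Filtration ℝ≥0 (inferInstance : MeasurableSpace Ω))
    {τ : Ω → WithTop ℝ≥0} (hτ : IsStoppingTime F τ) :
    stoppedSigma F hτ ≤ mΩ := fun _ hA => hA.1

lemma stoppedSigma_const (F : Filtration ℝ≥0 (inferInstance : MeasurableSpace Ω)) (s : ℝ≥0)
    (hτ : IsStoppingTime F (fun _ => (s : WithTop ℝ≥0))) : stoppedSigma F hτ = F s := by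
  have key : ∀ (A : Set Ω) (t : ℝ≥0), A ∩ {_ω : Ω | (s : WithTop ℝ≥0) ≤ t} = {ω ∈ A | s ≤ t} := by
    intro A t
    ext ω
    exact and_congr_right fun _ => WithTop.coe_le_coe
  refine le_antisymm (fun A hA => ?_) fun A hA => ⟨F.le s A hA, fun t => ?_⟩
  · have := hA.2 s
    rw [key] at this
    simpa using this
  · rw [key]
    by_cases h : s ≤ t
    · simpa [h] using F.mono h A hA
    · simp [h]

lemma measure_eq_lintegral_of_rnDeriv {P R : ProbabilityMeasure Ω}
    (hac : (R : Measure Ω) ≪ (P : Measure Ω)) {D : Ω → ℝ}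
    (h : (fun ω => ((R : Measure Ω).rnDeriv P ω).toReal) =ᵐ[(P : Measure Ω)] D) :
    (R : Measure Ω) = (P : Measure Ω).withDensity fun ω => ENNReal.ofReal (D ω) := by
  conv_lhs => rw [← Measure.withDensity_rnDeriv_eq _ _ hac]
  refine withDensity_congr_ae ?_
  filter_upwards [h, Measure.rnDeriv_lt_top (R : Measure Ω) (P : Measure Ω)] with ω h1 h2
  rw [← h1, ENNReal.ofReal_toReal h2.ne]

/-- Stopping the density process of `R` relative to `Q` at the constant time `s` gives the density
`D = E_Q(dR/dQ | F s)`. It reproduces `R` on `F s`, and being `F s`-measurable it leaves the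
conditional law of `Q` given `F s` unchanged. -/
theorem IsStable.followsOn [BorelSpace Ω] {F : Filtration ℝ≥0 (inferInstance : MeasurableSpace Ω)}
    {C : Set (ProbabilityMeasure Ω)} (h : IsStable F C)
    (P : ProbabilityMeasure Ω) (s : ℝ≥0) :
    FollowsOn (F s) (equivalents C P) := by
  intro Q hQ R hR
  have hτ : IsStoppingTime F (fun _ : Ω => (s : WithTop ℝ≥0)) := isStoppingTime_const F s
  obtain ⟨Q', hQ'C, hac, hd⟩ := h Q hQ.1.1 R hR.1.1 (equivalents_ac hR hQ) _ hτ
  rw [stoppedSigma_const] at hd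
  have hm := F.le s
  set L : Ω → ℝ := fun ω => ((R : Measure Ω).rnDeriv Q ω).toReal with hL
  set D : Ω → ℝ := (Q : Measure Ω)[L | F s] with hD
  have hLi : Integrable L (Q : Measure Ω) := Measure.integrable_toReal_rnDeriv
  have hDi : Integrable D (Q : Measure Ω) := integrable_condExp
  have hD0 : 0 ≤ᵐ[(Q : Measure Ω)] D :=
    condExp_nonneg (Eventually.of_forall fun ω => ENNReal.toReal_nonneg)
  have hDm : StronglyMeasurable[F s] D := stronglyMeasurable_condExp
  have hQ'd := measure_eq_lintegral_of_rnDeriv hac hd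
  have hset : ∀ A, MeasurableSet[F s] A → (Q' : Measure Ω).real A = (R : Measure Ω).real A := by
    intro A hA
    rw [← Measure.setIntegral_toReal_rnDeriv hac, ← Measure.setIntegral_toReal_rnDeriv
      (equivalents_ac hR hQ), ← setIntegral_condExp hm hLi hA]
    exact integral_congr_ae (ae_restrict_of_ae hd)
  have hagree : AgreeOn (F s) Q' R := fun A hA => by
    have := hset A hA
    rwa [measureReal_def, measureReal_def,
      ENNReal.toReal_eq_toReal_iff' (measure_ne_top _ _) (measure_ne_top _ _)] at this
  -- The set `{D ≤ 0}` is `Q'`-null and lies in `F s`, so it is null for `R` and thus for `Q`; a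
  -- positive density gives equivalence.
  have hQQ' : (Q : Measure Ω) ≪ (Q' : Measure Ω) := by
    have hpos : ∀ᵐ ω ∂(Q : Measure Ω), 0 < D ω := by
      have hB : MeasurableSet[F s] {ω | D ω ≤ 0} := hDm.measurable measurableSet_Iic
      have h0 : (Q' : Measure Ω) {ω | D ω ≤ 0} = 0 := by
        rw [hQ'd, withDensity_apply _ (hm _ hB)]
        refine (setLIntegral_congr_fun (hm _ hB) fun ω hω => ?_).trans lintegral_zero
        exact ENNReal.ofReal_eq_zero.2 hω
      rw [hagree _ hB] at h0
      have := equivalents_ac hQ hR h0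
      filter_upwards [measure_eq_zero_iff_ae_notMem.1 this] with ω hω using not_le.1 hω
    rw [hQ'd]
    refine withDensity_absolutelyContinuous' ?_ ?_
    · exact hDi.aestronglyMeasurable.aemeasurable.ennreal_ofReal
    · filter_upwards [hpos] with ω hω using (ENNReal.ofReal_pos.2 hω).ne'
  refine ⟨Q', ⟨⟨hQ'C, hac.trans hQ.1.2⟩, hQ.2.trans hQQ'⟩, hagree, fun f => ?_⟩
  have hint : ∀ (g : Ω → ℝ) (A : Set Ω), MeasurableSet A →
      ∫ ω in A, g ω ∂(Q' : Measure Ω) = ∫ ω in A, D ω * g ω ∂(Q : Measure Ω) := by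
    intro g A hA
    rw [hQ'd]
    have e : (fun ω => ENNReal.ofReal (D ω)) = fun ω => ((D ω).toNNReal : ℝ≥0∞) := rfl
    rw [e, setIntegral_withDensity_eq_setIntegral_smul (hDm.mono hm).measurable.real_toNNReal _ hA]
    refine integral_congr_ae (ae_restrict_of_ae ?_)
    filter_upwards [hD0] with ω hω
    simp [NNReal.smul_def, Real.coe_toNNReal _ hω]
  have hfi : Integrable f (Q : Measure Ω) := f.integrable _
  have hDf : Integrable (D * ⇑f) (Q : Measure Ω) :=
    hDi.mul_bdd (c := ‖f‖) f.continuous.aestronglyMeasurable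
      (Eventually.of_forall fun ω => f.norm_coe_le_norm ω)
  have hb : ∀ᵐ ω ∂(Q : Measure Ω), |((Q : Measure Ω)[f | F s]) ω| ≤ ‖f‖ :=
    ae_bdd_abs_condExp_of_ae_bdd_abs (Eventually.of_forall fun ω => f.norm_coe_le_norm ω)
  -- Bayes' rule: `E_Q(f | F s)` is also a version under `Q'`, since `D` can be pulled out of the
  -- conditional expectation under `Q`.
  refine hQQ'.ae_le (Filter.EventuallyEq.symm ?_)
  refine ae_eq_condExp_of_forall_setIntegral_eq hm (f.integrable _) (fun A _ _ => ?_)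
    (fun A hA _ => ?_) stronglyMeasurable_condExp.aestronglyMeasurable
  · refine Integrable.integrableOn ?_
    refine Integrable.of_bound (stronglyMeasurable_condExp.mono hm).aestronglyMeasurable ‖f‖ ?_
    exact hac.ae_le hb
  · rw [hint _ _ (hm _ hA), hint _ _ (hm _ hA)]
    have := condExp_mul_of_stronglyMeasurable_left hDm hDf hfi
    exact (integral_congr_ae (ae_restrict_of_ae this)).symm.trans (setIntegral_condExp hm hDf hA)

/-- Stop the density process of `Q'` relative to `Q` at `s` on `A` and never off `A`. On `A` its
value is `1`, because the two models agree on `F s`; off `A` it is `dQ'/dQ`. The resulting model is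
`Q` on `A` and `Q'` on the complement. -/
theorem IsStable.pastesOn {F : Filtration ℝ≥0 (inferInstance : MeasurableSpace Ω)}
    {C : Set (ProbabilityMeasure Ω)} (h : IsStable F C)
    (P : ProbabilityMeasure Ω) (s : ℝ≥0) :
    PastesOn (F s) (equivalents C P) := by
  classical
  intro Q hQ Q' hQ' hag A hA
  have hm := F.le s
  let τ : Ω → WithTop ℝ≥0 := fun ω => if ω ∈ A then (s : WithTop ℝ≥0) else ⊤
  have hτle : ∀ t : ℝ≥0, {ω | τ ω ≤ t} = if s ≤ t then A else ∅ := by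
    intro t
    ext ω
    have h1 : ω ∈ A → (τ ω ≤ t ↔ s ≤ t) := fun hω => by
      rw [show τ ω = _ from if_pos hω]
      exact WithTop.coe_le_coe
    have h2 : ω ∉ A → ¬ τ ω ≤ t := fun hω => by
      rw [show τ ω = _ from if_neg hω]
      exact not_le.2 (WithTop.coe_lt_top t)
    change τ ω ≤ t ↔ _
    by_cases hω : ω ∈ A
    · rw [h1 hω]
      by_cases hst : s ≤ t <;> simp [hω, hst]
    · simp only [h2 hω, false_iff]
      split_ifs <;> simp [hω]
  have hτ : IsStoppingTime F τ := fun t => by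
    rw [hτle t]
    split_ifs with hst
    · exact F.mono hst A hA
    · exact @MeasurableSet.empty _ (F t)
  obtain ⟨R, hRC, hac, hd⟩ := h Q hQ.1.1 Q' hQ'.1.1 (equivalents_ac hQ' hQ) τ hτ
  have hle := stoppedSigma_le F hτ
  set L : Ω → ℝ := fun ω => ((Q' : Measure Ω).rnDeriv Q ω).toReal with hL
  have hLi : Integrable L (Q : Measure Ω) := Measure.integrable_toReal_rnDeriv
  have hLm : Measurable L := (Measure.measurable_rnDeriv _ _).ennreal_toReal
  let K : Ω → ℝ := A.piecewise (fun _ => 1) L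
  have hKi : Integrable K (Q : Measure Ω) :=
    Integrable.piecewise (hm _ hA) (integrable_const _).integrableOn hLi.integrableOn
  have hKm : Measurable K := measurable_const.piecewise (hm _ hA) hLm
  -- For finite `t` the set `{τ ≤ t}` is `A` or empty, and `K` is constant on `A`.
  have hKτ : Measurable[stoppedSigma F hτ] K := by
    intro B hB
    refine ⟨hKm hB, fun t => ?_⟩
    rw [hτle t]
    split_ifs with hst
    · have e : K ⁻¹' B ∩ A = if (1 : ℝ) ∈ B then A else ∅ := by
        ext ω
        by_cases hω : ω ∈ A <;> by_cases h1 : (1 : ℝ) ∈ B <;> simp [K, hω, h1]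
      rw [e]
      split_ifs
      · exact F.mono hst A hA
      · exact @MeasurableSet.empty _ (F t)
    · simp
  have hKset : ∀ B, MeasurableSet B → ∫ ω in B, K ω ∂(Q : Measure Ω) =
      (Q : Measure Ω).real (B ∩ A) + (Q' : Measure Ω).real (B ∩ Aᶜ) := by
    intro B hB
    rw [← integral_inter_add_sdiff (hm _ hA) hKi.integrableOn, sdiff_eq]
    congr 1
    · rw [setIntegral_congr_fun (hB.inter (hm _ hA)) (g := fun _ => (1 : ℝ))
        fun ω hω => by simp [K, hω.2]]
      simp
    · rw [← Measure.setIntegral_toReal_rnDeriv (equivalents_ac hQ' hQ)]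
      exact setIntegral_congr_fun (hB.inter (hm _ hA).compl) fun ω hω => by
        have : ω ∉ A := hω.2
        simp [K, this, hL]
  have hKL : K =ᵐ[(Q : Measure Ω)] (Q : Measure Ω)[L | stoppedSigma F hτ] := by
    refine ae_eq_condExp_of_forall_setIntegral_eq hle hLi (fun B _ _ => hKi.integrableOn)
      (fun B hB _ => ?_) hKτ.stronglyMeasurable.aestronglyMeasurable
    -- A set of the stopped σ-algebra has an `F s`-measurable trace on `A`, where agreement turns
    -- `Q` into `Q'`.
    have hBA : MeasurableSet[F s] (B ∩ A) := by
      have := hB.2 s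
      rwa [hτle s, if_pos le_rfl] at this
    rw [hKset B hB.1, measureReal_def, hag _ hBA, ← measureReal_def,
      Measure.setIntegral_toReal_rnDeriv (equivalents_ac hQ' hQ), ← sdiff_eq]
    exact measureReal_inter_add_sdiff (hm _ hA)
  have hset : ∀ B, MeasurableSet B →
      (R : Measure Ω) B = (Q : Measure Ω) (B ∩ A) + (Q' : Measure Ω) (B ∩ Aᶜ) := by
    intro B hB
    have e : (R : Measure Ω).real B = (Q : Measure Ω).real (B ∩ A) + (Q' : Measure Ω).real (B ∩ Aᶜ) := by
      rw [← hKset B hB, ← Measure.setIntegral_toReal_rnDeriv hac]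
      exact integral_congr_ae (ae_restrict_of_ae (hd.trans hKL.symm))
    simp only [measureReal_def] at e
    rw [← ENNReal.toReal_add (measure_ne_top _ _) (measure_ne_top _ _)] at e
    rwa [ENNReal.toReal_eq_toReal_iff' (measure_ne_top _ _)
      (ENNReal.add_ne_top.2 ⟨measure_ne_top _ _, measure_ne_top _ _⟩)] at e
  refine ⟨R, ⟨⟨hRC, hac.trans hQ.1.2⟩, ?_⟩, hset⟩
  refine Measure.AbsolutelyContinuous.mk fun B hB hB0 => ?_
  rw [hset B hB, add_eq_zero] at hB0
  have h1 := hQ.2 hB0.1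
  have h2 := hQ'.2 hB0.2
  rw [← inter_union_compl B A]
  exact measure_union_null h1 h2

end Pasting

/-! ### Elements of `L¹(c_ρ)` as random variables and their integrals -/

section Integrals

variable {Ω : Type} {m m' : MeasurableSpace Ω} [TopologicalSpace Ω] [mΩ : MeasurableSpace Ω]
  [BorelSpace Ω] {C : Set (ProbabilityMeasure Ω)} {P Q R : ProbabilityMeasure Ω}

lemma InUnitBallDual.integral_abs_le (h : InUnitBallDual C Q) (f : Ω →ᵇ ℝ) :
    ∫ ω, |f ω| ∂(Q : Measure Ω) ≤ capacity C f := by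
  have := h |f|
  simp only [capacity, abs_abs] at this
  exact (le_abs_self _).trans this

lemma inUnitBallDual_of_mem (hQ : Q ∈ C) : InUnitBallDual C Q := fun f =>
  abs_integral_le_integral_abs.trans (integral_abs_le_capacity ⟨Q, hQ⟩ f)

lemma inUnitBallDual_of_mem_equivalents (hQ : Q ∈ equivalents C P) : InUnitBallDual C Q :=
  inUnitBallDual_of_mem hQ.1.1

/-- The canonical map `(C_b(Ω), c_ρ) → L¹(Q)`. -/
def Cb.toLp (h : InUnitBallDual C Q) : Cb C →L[ℝ] Lp ℝ 1 (Q : Measure Ω) :=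
  LinearMap.mkContinuous
    { toFun := fun f => Integrable.toL1 f.fn (f.fn.integrable _)
      map_add' := fun f g => Integrable.toL1_add _ _ (f.fn.integrable _) (g.fn.integrable _)
      map_smul' := fun a f => Integrable.toL1_smul _ (f.fn.integrable _) a }
    1 fun f => by
      rw [one_mul]
      refine le_trans (le_of_eq ?_) (h.integral_abs_le f.fn)
      exact L1.norm_of_fun_eq_integral_norm (f.fn.integrable _)

open Classical in
/-- The canonical map `L¹(c_ρ) → L¹(Q)`, for `Q` in the unit ball of the dual of `L¹(c_ρ)`. -/
def L1c.toLp (C : Set (ProbabilityMeasure Ω)) (Q : ProbabilityMeasure Ω) :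
    L1c C →L[ℝ] Lp ℝ 1 (Q : Measure Ω) :=
  -- The default `0` keeps the map continuous and linear for every `Q`; the lemmas that evaluate it
  -- on functions assume `InUnitBallDual C Q`.
  if h : InUnitBallDual C Q then (Cb.toLp h).extend UniformSpace.Completion.toComplL else 0

lemma L1c.toLp_toL1c (h : InUnitBallDual C Q) (f : Ω →ᵇ ℝ) :
    L1c.toLp C Q (toL1c C f) = Integrable.toL1 f (f.integrable _) := by
  rw [L1c.toLp, dif_pos h]
  exact ContinuousLinearMap.extend_eq (e := UniformSpace.Completion.toComplL) (Cb.toLp h)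
    (UniformSpace.Completion.denseRange_coe (α := Cb C))
    (UniformSpace.Completion.isUniformInducing_coe (Cb C)) (toCb C f)

lemma norm_toL1c (f : Ω →ᵇ ℝ) : ‖toL1c C f‖ = capacity C f :=
  UniformSpace.Completion.norm_coe (toCb C f)

lemma denseRange_toL1c : DenseRange (toL1c C) :=
  UniformSpace.Completion.denseRange_coe (α := Cb C)

lemma L1c.coeFn_toLp_toL1c (h : InUnitBallDual C Q) (f : Ω →ᵇ ℝ) :
    L1c.toLp C Q (toL1c C f) =ᵐ[(Q : Measure Ω)] f := by
  rw [L1c.toLp_toL1c h]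
  exact Integrable.coeFn_toL1 _

lemma L1c.integrable_toLp (X : L1c C) : Integrable (L1c.toLp C Q X) (Q : Measure Ω) :=
  L1.integrable_coeFn _

lemma L1c.norm_toLp_le (h : InUnitBallDual C Q) (X : L1c C) : ‖L1c.toLp C Q X‖ ≤ ‖X‖ := by
  refine denseRange_toL1c.induction_on X
    (isClosed_le ((L1c.toLp C Q).continuous.norm) continuous_norm) fun f => ?_
  rw [L1c.toLp_toL1c h, norm_toL1c]
  exact (L1.norm_of_fun_eq_integral_norm (f.integrable _)).trans_le (h.integral_abs_le f)

lemma L1c.integral_abs_toLp_sub_le (h : InUnitBallDual C Q) (X : L1c C) (f : Ω →ᵇ ℝ) :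
    ∫ ω, |f ω - L1c.toLp C Q X ω| ∂(Q : Measure Ω) ≤ ‖X - toL1c C f‖ := by
  refine le_trans (le_of_eq ?_) (L1c.norm_toLp_le h (X - toL1c C f))
  rw [L1.norm_eq_integral_norm, map_sub]
  refine integral_congr_ae ?_
  filter_upwards [Lp.coeFn_sub (L1c.toLp C Q X) (L1c.toLp C Q (toL1c C f)),
    L1c.coeFn_toLp_toL1c h f] with ω h1 h2
  rw [h1, Pi.sub_apply, h2, Real.norm_eq_abs, abs_sub_comm]

/-- A version of `X` under `P` is a version of `X` under every `Q` equivalent to `P`. -/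
lemma L1c.EqAS.toLp_ae_eq (h : InUnitBallDual C Q) (hac : (Q : Measure Ω) ≪ (P : Measure Ω))
    {X : L1c C} {g : Ω → ℝ} (hg : X.EqAS P g) : L1c.toLp C Q X =ᵐ[(Q : Measure Ω)] g := by
  have hpos : ∀ n : ℕ, (0 : ℝ) < ((n : ℝ) + 1)⁻¹ := fun n => by positivity
  choose f hf1 hf2 using fun n : ℕ => hg.2 _ (hpos n)
  have hlim : Tendsto (fun n : ℕ => ((n : ℝ) + 1)⁻¹) atTop (𝓝 0) := by
    simpa using tendsto_one_div_add_atTop_nhds_zero_nat (𝕜 := ℝ)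
  have key : ∀ (S : ProbabilityMeasure Ω) (g' : Ω → ℝ), Integrable g' (S : Measure Ω) →
      (∀ n, ∫ ω, |f n ω - g' ω| ∂(S : Measure Ω) ≤ ((n : ℝ) + 1)⁻¹) →
      TendstoInMeasure (S : Measure Ω) (fun n => (f n : Ω → ℝ)) atTop g' := by
    intro S g' hg' hle
    refine tendstoInMeasure_of_tendsto_eLpNorm (p := 1) one_ne_zero
      (fun n => (f n).continuous.aestronglyMeasurable) hg'.aestronglyMeasurable ?_
    have e : ∀ n, eLpNorm (⇑(f n) - g') 1 (S : Measure Ω) =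
        ENNReal.ofReal (∫ ω, |f n ω - g' ω| ∂(S : Measure Ω)) := by
      intro n
      rw [eLpNorm_one_eq_lintegral_enorm, ← ofReal_integral_norm_eq_lintegral_enorm
        (((f n).integrable _).sub hg')]
      rfl
    simp only [e]
    rw [← ENNReal.ofReal_zero]
    refine (ENNReal.continuous_ofReal.tendsto 0).comp ?_
    exact squeeze_zero (fun n => integral_nonneg fun ω => abs_nonneg _) hle hlim
  -- The same functions `f n` tend to `g` in `L¹(P)` and to the image of `X` in `L¹(Q)`. Along
  -- nested subsequences both limits hold almost everywhere, and absolute continuity lets them be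
  -- compared under `Q`.
  have hP := key P g hg.1 fun n => (hf2 n).le
  obtain ⟨φ, hφ, hPae⟩ := hP.exists_seq_tendsto_ae
  have hQ := key Q (L1c.toLp C Q X) X.integrable_toLp
    fun n => (L1c.integral_abs_toLp_sub_le h X (f n)).trans (hf1 n).le
  have hQ' : TendstoInMeasure (Q : Measure Ω) (fun n => (f (φ n) : Ω → ℝ)) atTop
      (L1c.toLp C Q X) := fun ε hε => (hQ ε hε).comp hφ.tendsto_atTop
  obtain ⟨ψ, hψ, hQae⟩ := hQ'.exists_seq_tendsto_ae
  filter_upwards [hQae, hac.ae_le hPae] with ω h1 h2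
  exact tendsto_nhds_unique h1 (h2.comp hψ.tendsto_atTop)

lemma L1c.eqAS_toLp (h : InUnitBallDual C Q) (X : L1c C) : X.EqAS Q (L1c.toLp C Q X) := by
  refine ⟨X.integrable_toLp, fun ε hε => ?_⟩
  obtain ⟨f, hf⟩ := Metric.denseRange_iff.1 (denseRange_toL1c (C := C)) X ε hε
  rw [dist_eq_norm] at hf
  exact ⟨f, hf, (L1c.integral_abs_toLp_sub_le h X f).trans_lt hf⟩

/-- The integral of `X ∈ L¹(c_ρ)` over the set `A` under `Q`. -/
def L1c.setInt (Q : ProbabilityMeasure Ω) (A : Set Ω) : L1c C →L[ℝ] ℝ :=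
  (L1.integralCLM (μ := (Q : Measure Ω).restrict A)).comp
    ((LpToLpRestrictCLM Ω ℝ ℝ (Q : Measure Ω) 1 A).comp (L1c.toLp C Q))

lemma L1c.setInt_apply (A : Set Ω) (X : L1c C) :
    L1c.setInt Q A X = ∫ ω in A, L1c.toLp C Q X ω ∂(Q : Measure Ω) := by
  rw [L1c.setInt, ContinuousLinearMap.comp_apply, ContinuousLinearMap.comp_apply,
    ← L1.integral_eq, L1.integral_eq_integral]
  exact integral_congr_ae (LpToLpRestrictCLM_coeFn ℝ A _)

lemma L1c.setInt_toL1c (h : InUnitBallDual C Q) (A : Set Ω) (f : Ω →ᵇ ℝ) :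
    L1c.setInt Q A (toL1c C f) = ∫ ω in A, f ω ∂(Q : Measure Ω) := by
  rw [L1c.setInt_apply]
  exact integral_congr_ae (ae_restrict_of_ae (L1c.coeFn_toLp_toL1c h f))

lemma L1c.setInt_eq_of_eqAS (h : InUnitBallDual C Q) (hac : (Q : Measure Ω) ≪ (P : Measure Ω))
    {X : L1c C} {g : Ω → ℝ} (hg : X.EqAS P g) (A : Set Ω) :
    L1c.setInt Q A X = ∫ ω in A, g ω ∂(Q : Measure Ω) := by
  rw [L1c.setInt_apply]
  exact integral_congr_ae (ae_restrict_of_ae (hg.toLp_ae_eq h hac))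

lemma L1c.abs_setInt_le (h : InUnitBallDual C Q) (A : Set Ω) (X : L1c C) :
    |L1c.setInt Q A X| ≤ ‖X‖ := by
  rw [L1c.setInt_apply]
  refine (abs_integral_le_integral_abs.trans (setIntegral_le_integral X.integrable_toLp.abs
    (Eventually.of_forall fun _ => abs_nonneg _))).trans ?_
  exact (L1.norm_eq_integral_norm _).symm.trans_le (L1c.norm_toLp_le h X)

lemma L1c.setInt_add_compl {A : Set Ω} (hA : MeasurableSet A) (X : L1c C) :
    L1c.setInt Q A X + L1c.setInt Q Aᶜ X = L1c.setInt Q univ X := by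
  simp only [L1c.setInt_apply, Measure.restrict_univ]
  exact integral_add_compl hA X.integrable_toLp

lemma L1c.setInt_congr (hQ : InUnitBallDual C Q) (hR : InUnitBallDual C R) {A : Set Ω}
    (h : (Q : Measure Ω).restrict A = (R : Measure Ω).restrict A) (X : L1c C) :
    L1c.setInt Q A X = L1c.setInt R A X := by
  refine denseRange_toL1c.induction_on X
    (isClosed_eq (L1c.setInt Q A).continuous (L1c.setInt R A).continuous) fun f => ?_
  rw [L1c.setInt_toL1c hQ, L1c.setInt_toL1c hR, h]

variable (C m) in
/-- The elements of `L¹(c_ρ)` that are limits of `m`-measurable bounded continuous functions. -/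
def adapted : Submodule ℝ (L1c C) :=
  Submodule.topologicalClosure <| Submodule.map (toL1c C)
    { carrier := {f | StronglyMeasurable[m] f}
      add_mem' := fun hf hg => StronglyMeasurable.add hf hg
      zero_mem' := stronglyMeasurable_const
      smul_mem' := fun a _ hf => StronglyMeasurable.const_smul hf a }

lemma adapted_induction {p : L1c C → Prop} (hc : IsClosed {X | p X})
    (h : ∀ f : Ω →ᵇ ℝ, StronglyMeasurable[m] f → p (toL1c C f)) {X : L1c C} (hX : X ∈ adapted m C) :
    p X := by
  refine closure_minimal ?_ hc hX
  rintro _ ⟨f, hf, rfl⟩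
  exact h f hf

lemma exists_near_of_mem_adapted {X : L1c C} (hX : X ∈ adapted m C) {ε : ℝ} (hε : 0 < ε) :
    ∃ f : Ω →ᵇ ℝ, StronglyMeasurable[m] f ∧ ‖X - toL1c C f‖ < ε := by
  obtain ⟨_, ⟨f, hf, rfl⟩, h⟩ := Metric.mem_closure_iff.1 hX ε hε
  exact ⟨f, hf, by rwa [dist_eq_norm] at h⟩

lemma AgreeOn.setInt_eq (h : AgreeOn m Q R) (hm : m ≤ mΩ) (hQ : InUnitBallDual C Q)
    (hR : InUnitBallDual C R) {A : Set Ω} (hA : MeasurableSet[m] A) {X : L1c C}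
    (hX : X ∈ adapted m C) : L1c.setInt Q A X = L1c.setInt R A X := by
  refine adapted_induction
    (isClosed_eq (L1c.setInt Q A).continuous (L1c.setInt R A).continuous) (fun f hf => ?_) hX
  rw [L1c.setInt_toL1c hQ, L1c.setInt_toL1c hR, h.setIntegral_eq hm hf hA]

/-- The random variable that represents an element of `adapted m C` under `Q` is `m`-measurable. -/
lemma condExp_toLp_of_mem_adapted (hm : m ≤ mΩ) (hQ : InUnitBallDual C Q) {X : L1c C}
    (hX : X ∈ adapted m C) :
    (Q : Measure Ω)[L1c.toLp C Q X | m] =ᵐ[(Q : Measure Ω)] L1c.toLp C Q X := by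
  have key : condExpL1CLM ℝ hm (Q : Measure Ω) (L1c.toLp C Q X) = L1c.toLp C Q X := by
    refine adapted_induction (p := fun X => condExpL1CLM ℝ hm (Q : Measure Ω) (L1c.toLp C Q X) =
      L1c.toLp C Q X) (isClosed_eq
      ((condExpL1CLM ℝ hm (Q : Measure Ω)).continuous.comp (L1c.toLp C Q).continuous)
      (L1c.toLp C Q).continuous) (fun f hf => ?_) hX
    rw [L1c.toLp_toL1c hQ]
    refine condExpL1CLM_of_aestronglyMeasurable' _ ?_
    exact hf.aestronglyMeasurable.congr (Integrable.coeFn_toL1 (f.integrable _)).symm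
  have h1 := condExp_ae_eq_condExpL1CLM hm (X.integrable_toLp (Q := Q))
  rw [Integrable.toL1_coeFn, key] at h1
  exact h1

end Integrals

/-! ### Conditional risks: order, uniqueness, time consistency and contraction -/

section ConditionalRisk

variable {Ω : Type} {m m' : MeasurableSpace Ω} [TopologicalSpace Ω] [mΩ : MeasurableSpace Ω]
  [BorelSpace Ω] {C : Set (ProbabilityMeasure Ω)} {P Q R : ProbabilityMeasure Ω}

lemma capacity_eq_equivalents (hrep : ∀ X : Ω →ᵇ ℝ, riskOf C X = riskOf (equivalents C P) X)
    (f : Ω →ᵇ ℝ) : capacity C f = capacity (equivalents C P) f := hrep _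

/-- Turns an `L¹` norm into integrals over the sign set, which belongs to `m` when `f` is
`m`-measurable. -/
lemma integral_abs_eq (Q : ProbabilityMeasure Ω) (f : Ω →ᵇ ℝ) :
    ∫ ω, |f ω| ∂(Q : Measure Ω) =
      ∫ ω in {ω | 0 ≤ f ω}, f ω ∂(Q : Measure Ω) - ∫ ω in {ω | 0 ≤ f ω}ᶜ, f ω ∂(Q : Measure Ω) := by
  have hA : MeasurableSet {ω | 0 ≤ f ω} := measurableSet_le measurable_const f.continuous.measurable
  rw [← integral_add_compl hA (f.integrable _).abs, sub_eq_add_neg, ← integral_neg]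
  congr 1
  · exact setIntegral_congr_fun hA fun ω hω => abs_of_nonneg hω
  · exact setIntegral_congr_fun hA.compl fun ω hω => abs_of_neg (not_le.1 hω)

lemma measurableSet_nonneg {f : Ω → ℝ} (hf : StronglyMeasurable[m] f) :
    MeasurableSet[m] {ω | 0 ≤ f ω} := hf.measurable measurableSet_Ici

/-- The norm of an element of `adapted m C` is controlled by its integrals over the sets of `m`. -/
lemma norm_le_of_setInt_le (hrep : ∀ X : Ω →ᵇ ℝ, riskOf C X = riskOf (equivalents C P) X)
    {W : L1c C} (hW : W ∈ adapted m C) {M : ℝ} (hM : 0 ≤ M)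
    (h : ∀ R ∈ equivalents C P, ∀ A, MeasurableSet[m] A →
      L1c.setInt R A W - L1c.setInt R Aᶜ W ≤ M) : ‖W‖ ≤ M := by
  refine le_of_forall_pos_le_add fun ε hε => ?_
  -- One `ε / 3` pays for replacing `W` by `f` in the norm, the other two for the integrals over the
  -- sign set of `f` and its complement.
  obtain ⟨f, hf, hWf⟩ := exists_near_of_mem_adapted hW (show (0 : ℝ) < ε / 3 by positivity)
  have key : ‖toL1c C f‖ ≤ M + ε / 3 + ε / 3 := by
    rw [norm_toL1c, capacity_eq_equivalents hrep]
    refine capacity_le (by positivity) fun ⟨R, hR⟩ => ?_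
    have hR' := inUnitBallDual_of_mem_equivalents hR
    have h1 := h R hR _ (measurableSet_nonneg hf)
    have h2 := L1c.abs_setInt_le hR' {ω | 0 ≤ f ω} (W - toL1c C f)
    have h3 := L1c.abs_setInt_le hR' {ω | 0 ≤ f ω}ᶜ (W - toL1c C f)
    rw [map_sub, L1c.setInt_toL1c hR', abs_le] at h2 h3
    rw [integral_abs_eq]
    linarith [h2.1, h3.2]
  calc ‖W‖ = ‖(W - toL1c C f) + toL1c C f‖ := by rw [sub_add_cancel]
    _ ≤ ‖W - toL1c C f‖ + ‖toL1c C f‖ := norm_add_le _ _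
    _ ≤ M + ε := by linarith

/-- An element of `adapted m C` is nonnegative if its integrals over the sets of `m` are. -/
lemma le_of_setInt_le (hrep : ∀ X : Ω →ᵇ ℝ, riskOf C X = riskOf (equivalents C P) X)
    {X Y : L1c C} (hX : X ∈ adapted m C) (hY : Y ∈ adapted m C)
    (h : ∀ R ∈ equivalents C P, ∀ A, MeasurableSet[m] A → L1c.setInt R A X ≤ L1c.setInt R A Y) :
    L1c.Le X Y := by
  refine Metric.mem_closure_iff.2 fun ε hε => ?_
  obtain ⟨f, hf, hWf⟩ :=
    exists_near_of_mem_adapted (Submodule.sub_mem _ hY hX) (show (0 : ℝ) < ε / 2 by positivity)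
  -- The error of `f ⊔ 0` is the negative part of `f`, supported on a set of `m` over which `Y - X`
  -- has nonnegative integral; so it is at most the error of `f`.
  refine ⟨_, ⟨f ⊔ 0, (le_sup_right : (0 : Ω →ᵇ ℝ) ≤ f ⊔ 0), rfl⟩, ?_⟩
  have key : ‖toL1c C f - toL1c C (f ⊔ 0)‖ ≤ ε / 2 := by
    rw [← map_sub, norm_toL1c, capacity_eq_equivalents hrep]
    refine capacity_le (by positivity) fun ⟨R, hR⟩ => ?_
    have hR' := inUnitBallDual_of_mem_equivalents hR
    have hA := measurableSet_nonneg hf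
    have hA' : MeasurableSet {ω | 0 ≤ f ω} :=
      measurableSet_le measurable_const f.continuous.measurable
    have h1 := h R hR _ (MeasurableSet.compl hA)
    have h2 := L1c.abs_setInt_le hR' {ω | 0 ≤ f ω}ᶜ (Y - X - toL1c C f)
    rw [map_sub, map_sub, L1c.setInt_toL1c hR', abs_le] at h2
    have h3 : ∫ ω, |(f - f ⊔ 0) ω| ∂(R : Measure Ω) =
        - ∫ ω in {ω | 0 ≤ f ω}ᶜ, f ω ∂(R : Measure Ω) := by
      rw [← integral_neg, ← integral_indicator hA'.compl]
      refine integral_congr_ae (Eventually.of_forall fun ω => ?_)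
      change |f ω - max (f ω) 0| = _
      by_cases hω : 0 ≤ f ω
      · simp [hω]
      · have : f ω ≤ 0 := (not_le.1 hω).le
        simp [hω, this, abs_of_nonpos this]
    rw [h3]
    linarith [h2.2]
  rw [dist_eq_norm]
  calc ‖Y - X - toL1c C (f ⊔ 0)‖ = ‖(Y - X - toL1c C f) + (toL1c C f - toL1c C (f ⊔ 0))‖ := by
        rw [sub_add_sub_cancel]
    _ ≤ ‖Y - X - toL1c C f‖ + ‖toL1c C f - toL1c C (f ⊔ 0)‖ := norm_add_le _ _
    _ < ε := by linarith

lemma L1c.Le.setInt_le {X Y : L1c C} (h : L1c.Le X Y) (hQ : InUnitBallDual C Q) (A : Set Ω) :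
    L1c.setInt Q A X ≤ L1c.setInt Q A Y := by
  have : Y - X ∈ {W | 0 ≤ L1c.setInt Q A W} := by
    refine closure_minimal ?_ (isClosed_le continuous_const (L1c.setInt Q A).continuous) h
    rintro _ ⟨f, hf, rfl⟩
    rw [mem_ofPred_eq, L1c.setInt_toL1c hQ]
    exact integral_nonneg fun ω => hf ω
  rw [mem_ofPred_eq, map_sub] at this
  linarith

variable (m P) in
/-- `Z` is an upper bound of all the conditional expectations `E_Q(-X | m)`, `Q ∼ P`. -/
def DominatesRisk (X Z : L1c C) : Prop :=
  ∀ Q ∈ equivalents C P, ∀ A, MeasurableSet[m] A → L1c.setInt Q A (-X) ≤ L1c.setInt Q A Z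

variable (m P) in
/-- `Z` is an upper bound of all the conditional expectations `E_Q(-X | m)`, `Q ∼ P`, and is
approximated by them in `L¹(R)`, for every `R ∼ P`. -/
structure CondRisk (X Z : L1c C) : Prop where
  mem : Z ∈ adapted m C
  dominates : DominatesRisk m P X Z
  approx : ∀ R ∈ equivalents C P, ∀ ε > 0, ∃ Q ∈ equivalents C P, AgreeOn m Q R ∧
    L1c.setInt R univ Z ≤ L1c.setInt Q univ (-X) + ε

/-- The approximation also holds on every set of `m`. -/
lemma CondRisk.approx_on (hm : m ≤ mΩ) {X Z : L1c C} (h : CondRisk m P X Z)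
    (hR : R ∈ equivalents C P) {ε : ℝ} (hε : 0 < ε) :
    ∃ Q ∈ equivalents C P, AgreeOn m Q R ∧ ∀ A, MeasurableSet[m] A →
      L1c.setInt R A Z ≤ L1c.setInt Q A (-X) + ε := by
  obtain ⟨Q, hQ, hag, hle⟩ := h.approx R hR ε hε
  refine ⟨Q, hQ, hag, fun A hA => ?_⟩
  -- Subtract from the total approximation the domination on the complement, where `Z` has the same
  -- integral under `Q` and `R`.
  have h1 := h.dominates Q hQ Aᶜ hA.compl
  have h2 := hag.setInt_eq hm (inUnitBallDual_of_mem_equivalents hQ)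
    (inUnitBallDual_of_mem_equivalents hR) hA.compl h.mem
  have h3 := L1c.setInt_add_compl (Q := R) (hm A hA) Z
  have h4 := L1c.setInt_add_compl (Q := Q) (hm A hA) (-X)
  linarith

/-- A conditional risk lies below every other upper bound. -/
lemma CondRisk.le (hrep : ∀ X : Ω →ᵇ ℝ, riskOf C X = riskOf (equivalents C P) X) (hm : m ≤ mΩ)
    {X Z W : L1c C} (h : CondRisk m P X Z) (hW : W ∈ adapted m C) (hd : DominatesRisk m P X W) :
    L1c.Le Z W := by
  refine le_of_setInt_le hrep h.mem hW fun R hR A hA => le_of_forall_pos_le_add fun ε hε => ?_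
  obtain ⟨Q, hQ, hag, hle⟩ := h.approx_on hm hR hε
  rw [← hag.setInt_eq hm (inUnitBallDual_of_mem_equivalents hQ)
    (inUnitBallDual_of_mem_equivalents hR) hA hW]
  linarith [hle A hA, hd Q hQ A hA]

lemma CondRisk.unique (hrep : ∀ X : Ω →ᵇ ℝ, riskOf C X = riskOf (equivalents C P) X)
    (hm : m ≤ mΩ) {X Z W : L1c C} (h : CondRisk m P X Z) (h' : CondRisk m P X W) : Z = W := by
  rw [← sub_eq_zero, ← norm_le_zero_iff]
  refine norm_le_of_setInt_le hrep (Submodule.sub_mem _ h.mem h'.mem) le_rfl fun R hR A _ => ?_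
  have hR' := inUnitBallDual_of_mem_equivalents hR
  have h1 := (h.le hrep hm h'.mem h'.dominates).setInt_le hR' A
  have h2 := (h'.le hrep hm h.mem h.dominates).setInt_le hR' Aᶜ
  rw [map_sub, map_sub]
  linarith

lemma CondRisk.anti (hrep : ∀ X : Ω →ᵇ ℝ, riskOf C X = riskOf (equivalents C P) X)
    (hm : m ≤ mΩ) {X Y Z W : L1c C} (hX : CondRisk m P X Z) (hY : CondRisk m P Y W)
    (hXY : L1c.Le X Y) : L1c.Le W Z := by
  refine hY.le hrep hm hX.mem fun Q hQ A hA => ?_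
  have h1 := hX.dominates Q hQ A hA
  have h2 := hXY.setInt_le (inUnitBallDual_of_mem_equivalents hQ) A
  rw [map_neg] at h1 ⊢
  linarith

/-- The approximating model agrees with `R` on `m`, so the adapted term has the same expectation
under both and cancels. -/
lemma CondRisk.add_adapted (hm : m ≤ mΩ) {X Y Z : L1c C} (h : CondRisk m P X Z)
    (hY : Y ∈ adapted m C) : CondRisk m P (X + Y) (Z - Y) where
  mem := Submodule.sub_mem _ h.mem hY
  dominates Q hQ A hA := by
    have := h.dominates Q hQ A hA
    rw [map_neg] at this
    rw [map_neg, map_add, map_sub]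
    linarith
  approx R hR ε hε := by
    obtain ⟨Q, hQ, hag, hle⟩ := h.approx R hR ε hε
    refine ⟨Q, hQ, hag, ?_⟩
    have := hag.setInt_eq hm (inUnitBallDual_of_mem_equivalents hQ)
      (inUnitBallDual_of_mem_equivalents hR) MeasurableSet.univ hY
    rw [map_neg] at hle
    rw [map_neg, map_add, map_sub]
    linarith

lemma CondRisk.smul {X Z : L1c C} (h : CondRisk m P X Z) {a : ℝ} (ha : 0 ≤ a) :
    CondRisk m P (a • X) (a • Z) where
  mem := Submodule.smul_mem _ _ h.mem
  dominates Q hQ A hA := by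
    rw [← smul_neg, map_smul, map_smul]
    exact mul_le_mul_of_nonneg_left (h.dominates Q hQ A hA) ha
  approx R hR ε hε := by
    -- Dividing by `a + 1` rather than `a` covers `a = 0`.
    obtain ⟨Q, hQ, hag, hle⟩ := h.approx R hR (ε / (a + 1)) (by positivity)
    refine ⟨Q, hQ, hag, ?_⟩
    rw [← smul_neg, map_smul, map_smul, smul_eq_mul, smul_eq_mul]
    have h1 := mul_le_mul_of_nonneg_left hle ha
    have h2 : a * (ε / (a + 1)) ≤ ε := by
      rw [mul_div_assoc', div_le_iff₀ (by positivity)]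
      nlinarith
    linarith

lemma DominatesRisk.add {X Y Z W : L1c C} (hX : DominatesRisk m P X Z)
    (hY : DominatesRisk m P Y W) : DominatesRisk m P (X + Y) (Z + W) := fun Q hQ A hA => by
  rw [neg_add, map_add, map_add]
  exact add_le_add (hX Q hQ A hA) (hY Q hQ A hA)

/-- Time consistency: the risk at an earlier time of the risk at a later time. -/
lemma CondRisk.trans (hmm : m ≤ m') {X Z W : L1c C} (h : CondRisk m' P X Z)
    (h' : CondRisk m P (-Z) W) : CondRisk m P X W where
  mem := h'.mem
  dominates Q hQ A hA := by
    have := h'.dominates Q hQ A hA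
    rw [neg_neg] at this
    exact (h.dominates Q hQ A (hmm A hA)).trans this
  approx R hR ε hε := by
    -- `Q` keeps the law of `R` on `m` and nearly attains `W`; `Q'` keeps the law of `Q` on the
    -- larger `m'` and nearly attains `Z`. The second choice starts from `Q`, which is why
    -- approximation is required from every model.
    obtain ⟨Q, hQ, hag, hle⟩ := h'.approx R hR (ε / 2) (by positivity)
    obtain ⟨Q', hQ', hag', hle'⟩ := h.approx Q hQ (ε / 2) (by positivity)
    rw [neg_neg] at hle
    exact ⟨Q', hQ', (hag'.mono hmm).trans hag, by linarith⟩

/-- Conditional risks are contractions for the norm of `L¹(c_ρ)`. -/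
lemma CondRisk.norm_sub_le (hrep : ∀ X : Ω →ᵇ ℝ, riskOf C X = riskOf (equivalents C P) X)
    (hm : m ≤ mΩ) (hpaste : PastesOn m (equivalents C P)) {X X' Z Z' : L1c C}
    (h : CondRisk m P X Z) (h' : CondRisk m P X' Z') : ‖Z - Z'‖ ≤ ‖X - X'‖ := by
  refine norm_le_of_setInt_le hrep (Submodule.sub_mem _ h.mem h'.mem) (norm_nonneg _)
    fun R hR A hA => le_of_forall_pos_le_add fun ε hε => ?_
  obtain ⟨Q, hQ, hag, hle⟩ := h.approx_on hm hR (half_pos hε)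
  obtain ⟨Q', hQ', hag', hle'⟩ := h'.approx_on hm hR (half_pos hε)
  -- `Q` nearly attains `Z` on `A` and `Q'` nearly attains `Z'` off `A`. Crossing with the
  -- dominations of `Z'` and `Z` leaves integrals of `±(X' - X)` over complementary sets; under the
  -- single model `S` they sum to at most one norm instead of two.
  obtain ⟨S, hS, hSB⟩ := hpaste Q hQ Q' hQ' (hag.trans hag'.symm) A hA
  have hA' := hm A hA
  have iQ := inUnitBallDual_of_mem_equivalents hQ
  have iQ' := inUnitBallDual_of_mem_equivalents hQ'
  have iR := inUnitBallDual_of_mem_equivalents hR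
  have iS := inUnitBallDual_of_mem_equivalents hS
  have e1 : (S : Measure Ω).restrict A = (Q : Measure Ω).restrict A := by
    ext B hB
    rw [Measure.restrict_apply hB, Measure.restrict_apply hB, hSB _ (hB.inter hA')]
    simp [inter_assoc]
  have e2 : (S : Measure Ω).restrict Aᶜ = (Q' : Measure Ω).restrict Aᶜ := by
    ext B hB
    rw [Measure.restrict_apply hB, Measure.restrict_apply hB, hSB _ (hB.inter hA'.compl)]
    simp [inter_assoc]
  have d1 := h'.dominates Q hQ A hA
  have d2 := h.dominates Q' hQ' Aᶜ hA.compl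
  have a1 := hag.setInt_eq hm iQ iR hA h'.mem
  have a2 := hag'.setInt_eq hm iQ' iR hA.compl h.mem
  have l1 := hle A hA
  have l2 := hle' Aᶜ hA.compl
  have s1 := L1c.setInt_congr iS iQ e1 (X' - X)
  have s2 := L1c.setInt_congr iS iQ' e2 (X' - X)
  have b := L1c.norm_toLp_le iS (X' - X)
  have b' : L1c.setInt S A (X' - X) - L1c.setInt S Aᶜ (X' - X) ≤ ‖X - X'‖ := by
    rw [norm_sub_rev]
    refine le_trans ?_ b
    rw [L1.norm_eq_integral_norm, L1c.setInt_apply, L1c.setInt_apply,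
      ← integral_add_compl hA' (X' - X).integrable_toLp.norm, sub_eq_add_neg, ← integral_neg]
    have i := (X' - X).integrable_toLp (Q := S)
    exact add_le_add
      (integral_mono i.integrableOn i.norm.integrableOn fun ω => le_abs_self _)
      (integral_mono i.integrableOn.neg i.norm.integrableOn fun ω => neg_le_abs _)
  rw [map_neg] at d1 d2 l1 l2
  rw [map_sub, map_sub]
  simp only [map_sub] at s1 s2 b'
  linarith

/-- A conditional risk exists for every element of `L¹(c_ρ)` if it does on a dense set. -/
lemma exists_condRisk_of_dense (hrep : ∀ X : Ω →ᵇ ℝ, riskOf C X = riskOf (equivalents C P) X)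
    (hm : m ≤ mΩ) (hpaste : PastesOn m (equivalents C P)) {V : Submodule ℝ (L1c C)}
    (hV : IsClosed (V : Set (L1c C))) (hVm : V ≤ adapted m C) {D : Set (L1c C)} (hD : Dense D)
    (h : ∀ X ∈ D, ∃ Z ∈ V, CondRisk m P X Z) (X : L1c C) : ∃ Z ∈ V, CondRisk m P X Z := by
  obtain ⟨x, hxD, hx⟩ := mem_closure_iff_seq_limit.1 (hD X)
  choose z hzV hz using fun n => h (x n) (hxD n)
  have hcau : CauchySeq z := by
    rw [Metric.cauchySeq_iff']
    intro ε hε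
    obtain ⟨N, hN⟩ := Metric.cauchySeq_iff'.1 hx.cauchySeq ε hε
    refine ⟨N, fun n hn => lt_of_le_of_lt ?_ (hN n hn)⟩
    rw [dist_eq_norm, dist_eq_norm]
    exact (hz n).norm_sub_le hrep hm hpaste (hz N)
  obtain ⟨Z, hZ⟩ := cauchySeq_tendsto_of_complete hcau
  have hZV : Z ∈ V := hV.mem_of_tendsto hZ (Eventually.of_forall hzV)
  refine ⟨Z, hZV, hVm hZV, fun Q hQ A hA => ?_, fun R hR ε hε => ?_⟩
  · exact le_of_tendsto_of_tendsto' (((L1c.setInt Q A).continuous.tendsto _).comp hx.neg)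
      (((L1c.setInt Q A).continuous.tendsto _).comp hZ) fun n => (hz n).dominates Q hQ A hA
  · have e1 := Metric.tendsto_nhds.1 hx (ε / 3) (by positivity)
    have e2 := Metric.tendsto_nhds.1 hZ (ε / 3) (by positivity)
    -- `n` is fixed before the model `Q` is chosen: integrals are bounded by the norm uniformly over
    -- models.
    obtain ⟨n, h1, h2⟩ := (e1.and e2).exists
    obtain ⟨Q, hQ, hag, hle⟩ := (hz n).approx R hR (ε / 3) (by positivity)
    refine ⟨Q, hQ, hag, ?_⟩
    rw [dist_eq_norm] at h1 h2
    have b1 := L1c.abs_setInt_le (inUnitBallDual_of_mem_equivalents hQ) univ (x n - X)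
    have b2 := L1c.abs_setInt_le (inUnitBallDual_of_mem_equivalents hR) univ (z n - Z)
    rw [map_sub, abs_le] at b1 b2
    rw [map_neg] at hle ⊢
    linarith [b1.2, b2.1]

lemma condRisk_neg {X : L1c C} (hX : X ∈ adapted m C) : CondRisk m P X (-X) where
  mem := Submodule.neg_mem _ hX
  dominates _ _ _ _ := le_rfl
  approx R hR ε hε := ⟨R, hR, fun _ _ => rfl, by linarith⟩

/-! ### Multiplication by bounded continuous functions -/

lemma L1c.mul_toL1c (f g : Ω →ᵇ ℝ) : L1c.mul f (toL1c C g) = toL1c C (f * g) :=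
  UniformSpace.Completion.map_coe (Cb.uniformContinuous_mul f) (toCb C g)

lemma L1c.continuous_mul (f : Ω →ᵇ ℝ) : Continuous (L1c.mul (C := C) f) :=
  UniformSpace.Completion.continuous_map

/-- Over each set, both sides have integrals continuous in `X`, and these agree on bounded
continuous functions. -/
lemma L1c.toLp_mul (hQ : InUnitBallDual C Q) (f : Ω →ᵇ ℝ) (X : L1c C) :
    L1c.toLp C Q (L1c.mul f X) =ᵐ[(Q : Measure Ω)] fun ω => f ω * L1c.toLp C Q X ω := by
  have hi : ∀ Y : L1c C, Integrable (⇑f * ⇑(L1c.toLp C Q Y)) (Q : Measure Ω) := fun Y =>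
    Y.integrable_toLp.bdd_mul (c := ‖f‖) f.continuous.aestronglyMeasurable
      (Eventually.of_forall fun ω => f.norm_coe_le_norm ω)
  suffices h : ∀ A, L1c.setInt Q A (L1c.mul f X) =
      ∫ ω in A, f ω * L1c.toLp C Q X ω ∂(Q : Measure Ω) by
    refine Integrable.ae_eq_of_forall_setIntegral_eq _ _ (L1c.integrable_toLp _) (hi X)
      fun A _ _ => ?_
    rw [← L1c.setInt_apply]
    exact h A
  intro A
  have hlip : LipschitzWith ‖f‖₊
      fun Y : L1c C => ∫ ω in A, f ω * L1c.toLp C Q Y ω ∂(Q : Measure Ω) := by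
    refine LipschitzWith.of_dist_le_mul fun Y Y' => ?_
    have e := integral_sub (hi Y).integrableOn (hi Y').integrableOn (μ := (Q : Measure Ω).restrict A)
    simp only [Pi.mul_apply] at e
    rw [Real.dist_eq, ← e, dist_eq_norm]
    refine abs_integral_le_integral_abs.trans ?_
    refine (setIntegral_le_integral ((hi Y).sub (hi Y')).abs
      (Eventually.of_forall fun _ => abs_nonneg _)).trans ?_
    refine le_trans ?_ (mul_le_mul_of_nonneg_left (L1c.norm_toLp_le hQ (Y - Y')) (norm_nonneg f))
    rw [L1.norm_eq_integral_norm, ← integral_const_mul]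
    refine integral_mono_ae ((hi Y).sub (hi Y')).abs
      ((Y - Y').integrable_toLp.norm.const_mul _) ?_
    rw [map_sub]
    filter_upwards [Lp.coeFn_sub (L1c.toLp C Q Y) (L1c.toLp C Q Y')] with ω hω
    simp only [hω, Pi.sub_apply, Pi.mul_apply]
    rw [← mul_sub, abs_mul]
    exact mul_le_mul_of_nonneg_right (f.norm_coe_le_norm ω) (abs_nonneg _)
  refine denseRange_toL1c.induction_on X (isClosed_eq
    ((L1c.setInt Q A).continuous.comp (L1c.continuous_mul f)) hlip.continuous) fun g => ?_
  rw [L1c.mul_toL1c, L1c.setInt_toL1c hQ]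
  refine integral_congr_ae (ae_restrict_of_ae ?_)
  filter_upwards [L1c.coeFn_toLp_toL1c hQ g] with ω hω
  rw [hω]
  rfl

/-- `m`-measurable nonnegative factors preserve the nonnegativity of the integrals over `m`. -/
lemma setInt_mul_nonneg (hm : m ≤ mΩ) (hQ : InUnitBallDual C Q) {f : Ω →ᵇ ℝ}
    (hf : StronglyMeasurable[m] f) (hf0 : 0 ≤ f) {V : L1c C}
    (hV : ∀ A, MeasurableSet[m] A → 0 ≤ L1c.setInt Q A V) {A : Set Ω} (hA : MeasurableSet[m] A) :
    0 ≤ L1c.setInt Q A (L1c.mul f V) := by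
  have hi : Integrable (⇑f * ⇑(L1c.toLp C Q V)) (Q : Measure Ω) :=
    V.integrable_toLp.bdd_mul (c := ‖f‖) f.continuous.aestronglyMeasurable
      (Eventually.of_forall fun ω => f.norm_coe_le_norm ω)
  -- Only the conditional expectation of `V` given `m` is known to be nonnegative, not `V` itself;
  -- the factor `f` is pulled out of it below.
  have h0 : 0 ≤ᵐ[(Q : Measure Ω)] (Q : Measure Ω)[L1c.toLp C Q V | m] := by
    refine ae_le_of_ae_le_trim (hm := hm) ?_
    refine ae_nonneg_of_forall_setIntegral_nonneg
      (integrable_condExp.trim hm stronglyMeasurable_condExp) fun B hB _ => ?_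
    rw [← setIntegral_trim hm stronglyMeasurable_condExp hB,
      setIntegral_condExp hm V.integrable_toLp hB, ← L1c.setInt_apply]
    exact hV B hB
  rw [L1c.setInt_apply]
  have e : ∫ ω in A, L1c.toLp C Q (L1c.mul f V) ω ∂(Q : Measure Ω) =
      ∫ ω in A, (⇑f * ⇑(L1c.toLp C Q V)) ω ∂(Q : Measure Ω) :=
    integral_congr_ae (ae_restrict_of_ae (L1c.toLp_mul hQ f V))
  rw [e, ← setIntegral_condExp hm hi hA]
  refine integral_nonneg_of_ae (ae_restrict_of_ae ?_)
  filter_upwards [condExp_mul_of_stronglyMeasurable_left hf hi V.integrable_toLp, h0] with ω h1 h2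
  rw [h1]
  exact mul_nonneg (hf0 ω) h2

lemma L1c.mul_add (f : Ω →ᵇ ℝ) (X Y : L1c C) :
    L1c.mul f (X + Y) = L1c.mul f X + L1c.mul f Y := by
  refine denseRange_toL1c.induction_on₂ (p := fun X Y : L1c C =>
    L1c.mul f (X + Y) = L1c.mul f X + L1c.mul f Y) (isClosed_eq ?_ ?_) (fun g g' => ?_) X Y
  · exact (L1c.continuous_mul f).comp continuous_add
  · exact ((L1c.continuous_mul f).comp continuous_fst).add
      ((L1c.continuous_mul f).comp continuous_snd)
  · rw [← map_add, L1c.mul_toL1c, L1c.mul_toL1c, L1c.mul_toL1c, ← map_add, _root_.mul_add]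

/-- Domination means that `X + Z` has nonnegative integrals over the sets of `m`, a property
preserved by nonnegative `m`-measurable factors. -/
lemma DominatesRisk.mul (hm : m ≤ mΩ) {X Z : L1c C} (h : DominatesRisk m P X Z) {f : Ω →ᵇ ℝ}
    (hf : StronglyMeasurable[m] f) (hf0 : 0 ≤ f) :
    DominatesRisk m P (L1c.mul f X) (L1c.mul f Z) := fun Q hQ A hA => by
  have := setInt_mul_nonneg hm (inUnitBallDual_of_mem_equivalents hQ) hf hf0 (V := X + Z)
    (fun B hB => by
      have := h Q hQ B hB
      rw [map_neg] at this
      rw [map_add]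
      linarith) hA
  rw [L1c.mul_add, map_add] at this
  rw [map_neg]
  linarith

end ConditionalRisk

/-! ### Conditional risks and essential suprema of conditional losses -/

section EssentialSupremum

variable {Ω : Type} {m : MeasurableSpace Ω} [TopologicalSpace Ω] [mΩ : MeasurableSpace Ω]
  [BorelSpace Ω] {C : Set (ProbabilityMeasure Ω)} {P Q R : ProbabilityMeasure Ω}

lemma integrable_neg_coe (f : Ω →ᵇ ℝ) (Q : ProbabilityMeasure Ω) :
    Integrable (fun ω => -f ω) (Q : Measure Ω) := (f.integrable _).neg

variable (m) in
/-- The conditional expectation `E_Q(-f | m)`. -/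
def condLoss (f : Ω →ᵇ ℝ) (Q : ProbabilityMeasure Ω) : Ω → ℝ :=
  (Q : Measure Ω)[fun ω => -f ω | m]

lemma stronglyMeasurable_condLoss (f : Ω →ᵇ ℝ) (Q : ProbabilityMeasure Ω) :
    StronglyMeasurable[m] (condLoss m f Q) := stronglyMeasurable_condExp

lemma abs_condLoss_le (f : Ω →ᵇ ℝ) (hac : (R : Measure Ω) ≪ (Q : Measure Ω)) :
    ∀ᵐ ω ∂(R : Measure Ω), |condLoss m f Q ω| ≤ ‖f‖ :=
  hac.ae_le (ae_bdd_abs_condExp_of_ae_bdd_abs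
    (Eventually.of_forall fun ω => by rw [abs_neg]; exact f.norm_coe_le_norm ω))

lemma integrable_condLoss (hm : m ≤ mΩ) (f : Ω →ᵇ ℝ) (hac : (R : Measure Ω) ≪ (Q : Measure Ω)) :
    Integrable (condLoss m f Q) (R : Measure Ω) :=
  Integrable.of_bound ((stronglyMeasurable_condLoss f Q).mono hm).aestronglyMeasurable ‖f‖
    (abs_condLoss_le f hac)

lemma setIntegral_condLoss (hm : m ≤ mΩ) (hQ : InUnitBallDual C Q) (f : Ω →ᵇ ℝ) {A : Set Ω}
    (hA : MeasurableSet[m] A) :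
    ∫ ω in A, condLoss m f Q ω ∂(Q : Measure Ω) = L1c.setInt Q A (-toL1c C f) := by
  rw [condLoss, setIntegral_condExp hm (integrable_neg_coe f Q) hA, map_neg, L1c.setInt_toL1c hQ,
    integral_neg]

/-- The conditional loss is `m`-measurable, so `R` may be replaced by `Q` before applying the tower
property. -/
lemma AgreeOn.integral_condLoss (hm : m ≤ mΩ) (hag : AgreeOn m Q R) (hQ : InUnitBallDual C Q)
    (f : Ω →ᵇ ℝ) :
    ∫ ω, condLoss m f Q ω ∂(R : Measure Ω) = L1c.setInt Q univ (-toL1c C f) := by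
  rw [← hag.integral_eq hm (stronglyMeasurable_condLoss f Q),
    ← setIntegral_condLoss hm hQ f MeasurableSet.univ, Measure.restrict_univ]

/-- A conditional risk is the essential supremum of the conditional expectations. -/
lemma CondRisk.isEssSup (hm : m ≤ mΩ) (hP : InUnitBallDual C P) (hne : (equivalents C P).Nonempty)
    {f : Ω →ᵇ ℝ} {Z : L1c C} (h : CondRisk m P (toL1c C f) Z) :
    IsEssSup P {φ | ∃ Q ∈ equivalents C P, φ = condLoss m f Q} (L1c.toLp C P Z) := by
  have hZP := L1c.eqAS_toLp hP Z
  have hup : ∀ Q ∈ equivalents C P, condLoss m f Q ≤ᵐ[(P : Measure Ω)] L1c.toLp C P Z := by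
    intro Q hQ
    have iQ := inUnitBallDual_of_mem_equivalents hQ
    refine hQ.2.ae_le ?_
    have h1 : condLoss m f Q ≤ᵐ[(Q : Measure Ω)] (Q : Measure Ω)[L1c.toLp C Q Z | m] := by
      refine ae_le_of_ae_le_trim (hm := hm) ?_
      refine ae_le_of_forall_setIntegral_le
        ((integrable_condLoss hm f .rfl).trim hm (stronglyMeasurable_condLoss f Q))
        (integrable_condExp.trim hm stronglyMeasurable_condExp) fun A hA _ => ?_
      rw [← setIntegral_trim hm (stronglyMeasurable_condLoss f Q) hA,
        ← setIntegral_trim hm stronglyMeasurable_condExp hA, setIntegral_condLoss hm iQ f hA,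
        setIntegral_condExp hm Z.integrable_toLp hA, ← L1c.setInt_apply]
      exact h.dominates Q hQ A hA
    filter_upwards [h1, condExp_toLp_of_mem_adapted hm iQ h.mem, hZP.toLp_ae_eq iQ hQ.1.2]
      with ω h1 h2 h3
    rwa [h2, h3] at h1
  refine ⟨Z.integrable_toLp.aemeasurable, ?_, fun u hu hle => ?_⟩
  · rintro _ ⟨Q, hQ, rfl⟩
    exact hup Q hQ
  obtain ⟨R, hR⟩ := hne
  have iR := inUnitBallDual_of_mem_equivalents hR
  have hgR := hZP.toLp_ae_eq iR hR.1.2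
  have hgi : Integrable (L1c.toLp C P Z) (R : Measure Ω) := Z.integrable_toLp.congr hgR
  refine hR.2.ae_le ?_
  -- A competing bound `u` need not be integrable, so the positive part of `Z - u` is estimated by a
  -- lower integral: it lies below `Z - E_Q(-f | m)`, whose `R`-expectation is at most `ε` for the
  -- approximating `Q`.
  have h0 : ∫⁻ ω, ENNReal.ofReal (L1c.toLp C P Z ω - u ω) ∂(R : Measure Ω) = 0 := by
    refine le_antisymm (ENNReal.le_of_forall_pos_le_add fun ε hε _ => ?_) bot_le
    obtain ⟨Q, hQ, hag, hq⟩ := h.approx R hR ε hε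
    have iQ := inUnitBallDual_of_mem_equivalents hQ
    have hci := integrable_condLoss hm f (equivalents_ac hR hQ)
    calc ∫⁻ ω, ENNReal.ofReal (L1c.toLp C P Z ω - u ω) ∂(R : Measure Ω)
        ≤ ∫⁻ ω, ENNReal.ofReal (L1c.toLp C P Z ω - condLoss m f Q ω) ∂(R : Measure Ω) := by
          refine lintegral_mono_ae ?_
          filter_upwards [hR.1.2.ae_le (hle _ ⟨Q, hQ, rfl⟩)] with ω hω
          exact ENNReal.ofReal_le_ofReal (by linarith)
      _ = ENNReal.ofReal (∫ ω, (L1c.toLp C P Z ω - condLoss m f Q ω) ∂(R : Measure Ω)) := by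
          refine (ofReal_integral_eq_lintegral_ofReal (hgi.sub hci) ?_).symm
          filter_upwards [hR.1.2.ae_le (hup Q hQ)] with ω hω using sub_nonneg.2 hω
      _ ≤ 0 + ε := by
          rw [integral_sub hgi hci, hag.integral_condLoss hm iQ, zero_add,
            ← integral_congr_ae hgR]
          have e := L1c.setInt_apply (Q := R) univ Z
          rw [Measure.restrict_univ] at e
          rw [← e, ENNReal.ofReal_le_iff_le_toReal ENNReal.coe_ne_top]
          simp only [ENNReal.coe_toReal]
          linarith
  have h0' := (lintegral_eq_zero_iff'
    (hgi.aemeasurable.sub (hu.mono_ac hR.1.2)).ennreal_ofReal).1 h0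
  filter_upwards [h0'] with ω hω
  exact sub_nonpos.1 (ENNReal.ofReal_eq_zero.1 hω)

lemma restrict_eq_of_paste {S Q Q' : ProbabilityMeasure Ω} {A B : Set Ω}
    (h : ∀ B, MeasurableSet B →
      (S : Measure Ω) B = (Q : Measure Ω) (B ∩ A) + (Q' : Measure Ω) (B ∩ Aᶜ))
    (hB : MeasurableSet B) (hBA : B ⊆ A) :
    (S : Measure Ω).restrict B = (Q : Measure Ω).restrict B := by
  ext D hD
  rw [Measure.restrict_apply hD, Measure.restrict_apply hD, h _ (hD.inter hB)]
  rw [inter_assoc, inter_eq_left.2 hBA, inter_assoc,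
    (disjoint_compl_right_iff_subset.2 hBA).inter_eq]
  simp

lemma restrict_eq_of_paste_compl {S Q Q' : ProbabilityMeasure Ω} {A B : Set Ω}
    (h : ∀ B, MeasurableSet B →
      (S : Measure Ω) B = (Q : Measure Ω) (B ∩ A) + (Q' : Measure Ω) (B ∩ Aᶜ))
    (hB : MeasurableSet B) (hBA : B ⊆ Aᶜ) :
    (S : Measure Ω).restrict B = (Q' : Measure Ω).restrict B :=
  restrict_eq_of_paste (A := Aᶜ) (fun B hB => by rw [h B hB, compl_compl, add_comm]) hB hBA

/-- The conditional losses of the models which agree with `R` on `m` are directed upwards. -/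
lemma exists_condLoss_eq_sup (hm : m ≤ mΩ) (hpaste : PastesOn m (equivalents C P))
    (hR : R ∈ equivalents C P) (f : Ω →ᵇ ℝ) {Q₁ Q₂ : ProbabilityMeasure Ω}
    (h₁ : Q₁ ∈ equivalents C P) (hag₁ : AgreeOn m Q₁ R) (h₂ : Q₂ ∈ equivalents C P)
    (hag₂ : AgreeOn m Q₂ R) :
    ∃ Q ∈ equivalents C P, AgreeOn m Q R ∧
      condLoss m f Q =ᵐ[(R : Measure Ω)] condLoss m f Q₁ ⊔ condLoss m f Q₂ := by
  set φ₁ := condLoss m f Q₁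
  set φ₂ := condLoss m f Q₂
  have m₁ : StronglyMeasurable[m] φ₁ := stronglyMeasurable_condLoss f Q₁
  have m₂ : StronglyMeasurable[m] φ₂ := stronglyMeasurable_condLoss f Q₂
  -- Follow `Q₁` where its conditional loss is the larger one and `Q₂` elsewhere; this set is in
  -- `m`, so pasting applies.
  have hA : MeasurableSet[m] {ω | φ₂ ω ≤ φ₁ ω} := measurableSet_le m₂.measurable m₁.measurable
  set A := {ω | φ₂ ω ≤ φ₁ ω}
  obtain ⟨S, hS, hSB⟩ := hpaste Q₁ h₁ Q₂ h₂ (hag₁.trans hag₂.symm) A hA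
  have hag : AgreeOn m S R := fun B hB => by
    rw [hSB B (hm B hB), hag₁ _ (hB.inter hA), hag₂ _ (hB.inter hA.compl), ← Set.sdiff_eq]
    exact measure_inter_add_sdiff _ (hm A hA)
  have hint : Integrable (φ₁ ⊔ φ₂) (S : Measure Ω) :=
    (integrable_condLoss hm f (equivalents_ac hS h₁)).sup
      (integrable_condLoss hm f (equivalents_ac hS h₂))
  have hs : StronglyMeasurable[m] (φ₁ ⊔ φ₂) :=
    (m₁.measurable.sup m₂.measurable).stronglyMeasurable
  refine ⟨S, hS, hag, ?_⟩
  refine (equivalents_ac hR hS).ae_le (Filter.EventuallyEq.symm ?_)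
  refine ae_eq_condExp_of_forall_setIntegral_eq hm (integrable_neg_coe f S)
    (fun _ _ _ => hint.integrableOn) (fun B hB _ => ?_) hs.aestronglyMeasurable
  have hBA := hB.inter hA
  have hBA' := hB.inter hA.compl
  rw [← integral_inter_add_sdiff (hm A hA) hint.integrableOn,
    ← integral_inter_add_sdiff (hm A hA) (integrable_neg_coe f S).integrableOn, Set.sdiff_eq,
    restrict_eq_of_paste hSB (hm _ hBA) inter_subset_right,
    restrict_eq_of_paste_compl hSB (hm _ hBA') inter_subset_right]
  congr 1
  · rw [← setIntegral_condExp hm (integrable_neg_coe f Q₁) hBA]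
    exact setIntegral_congr_fun (hm _ hBA) fun ω hω => sup_eq_left.2 hω.2
  · rw [← setIntegral_condExp hm (integrable_neg_coe f Q₂) hBA']
    exact setIntegral_congr_fun (hm _ hBA') fun ω hω => sup_eq_right.2
      (not_le.1 (show ¬ φ₂ ω ≤ φ₁ ω from hω.2)).le

lemma exists_condLoss_eq_partialSups (hm : m ≤ mΩ) (hpaste : PastesOn m (equivalents C P))
    (hR : R ∈ equivalents C P) (f : Ω →ᵇ ℝ) {q : ℕ → ProbabilityMeasure Ω}
    (hq : ∀ n, q n ∈ equivalents C P) (hag : ∀ n, AgreeOn m (q n) R) (n : ℕ) :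
    ∃ Q ∈ equivalents C P, AgreeOn m Q R ∧
      condLoss m f Q =ᵐ[(R : Measure Ω)] partialSups (fun n => condLoss m f (q n)) n := by
  induction n with
  | zero => exact ⟨q 0, hq 0, hag 0, by rw [partialSups_zero]⟩
  | succ n ih =>
    obtain ⟨Q, hQ, hQR, h⟩ := ih
    obtain ⟨S, hS, hSR, h'⟩ :=
      exists_condLoss_eq_sup hm hpaste hR f hQ hQR (hq (n + 1)) (hag (n + 1))
    refine ⟨S, hS, hSR, ?_⟩
    rw [partialSups_add_one]
    filter_upwards [h, h'] with ω h1 h2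
    rw [h2, Pi.sup_apply, Pi.sup_apply, h1]

/-- Some upper bound of all conditional losses has an `R`-expectation that is the supremum of the
expected losses in the models which agree with `R` on `m`. -/
lemma exists_upperBound_condLoss (hm : m ≤ mΩ) (hpaste : PastesOn m (equivalents C P))
    (hfollow : FollowsOn m (equivalents C P)) (hR : R ∈ equivalents C P) (f : Ω →ᵇ ℝ) {ε : ℝ}
    (hε : 0 < ε) :
    ∃ u : Ω → ℝ, Measurable u ∧ Integrable u (R : Measure Ω) ∧
      (∀ Q ∈ equivalents C P, condLoss m f Q ≤ᵐ[(R : Measure Ω)] u) ∧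
      ∃ Q ∈ equivalents C P, AgreeOn m Q R ∧
        ∫ ω, u ω ∂(R : Measure Ω) ≤ L1c.setInt Q univ (-toL1c C f) + ε := by
  set T : Set ℝ :=
    (fun Q => L1c.setInt Q univ (-toL1c C f)) '' {Q | Q ∈ equivalents C P ∧ AgreeOn m Q R}
  have hTne : T.Nonempty := ⟨_, R, ⟨hR, fun _ _ => rfl⟩, rfl⟩
  have hTb : BddAbove T := by
    refine ⟨‖-toL1c C f‖, ?_⟩
    rintro _ ⟨Q, ⟨hQ, -⟩, rfl⟩
    exact (le_abs_self _).trans (L1c.abs_setInt_le (inUnitBallDual_of_mem_equivalents hQ) _ _)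
  set M := sSup T
  have hM : ∀ Q ∈ equivalents C P, AgreeOn m Q R →
      ∫ ω, condLoss m f Q ω ∂(R : Measure Ω) ≤ M := fun Q hQ hag => by
    rw [hag.integral_condLoss hm (inUnitBallDual_of_mem_equivalents hQ)]
    exact le_csSup hTb ⟨Q, ⟨hQ, hag⟩, rfl⟩
  obtain ⟨v, -, hv, hvT⟩ := exists_seq_tendsto_sSup hTne hTb
  choose q hq hqv using hvT
  set φ : ℕ → Ω → ℝ := fun n => condLoss m f (q n)
  -- The bound is the supremum along a sequence of models whose expected losses tend to `M`.
  set u : Ω → ℝ := fun ω => ⨆ n, φ n ω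
  have hφm : ∀ n, Measurable (φ n) := fun n =>
    ((stronglyMeasurable_condLoss f (q n)).mono hm).measurable
  have hum : Measurable u := Measurable.iSup hφm
  have hb : ∀ᵐ ω ∂(R : Measure Ω), ∀ n, |φ n ω| ≤ ‖f‖ :=
    ae_all_iff.2 fun n => abs_condLoss_le f (equivalents_ac hR (hq n).1)
  have hbdd : ∀ {ω}, (∀ n, |φ n ω| ≤ ‖f‖) → BddAbove (range fun n => φ n ω) := fun hω =>
    ⟨‖f‖, by rintro _ ⟨n, rfl⟩; exact (abs_le.1 (hω n)).2⟩
  have hub : ∀ᵐ ω ∂(R : Measure Ω), |u ω| ≤ ‖f‖ := by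
    filter_upwards [hb] with ω hω
    exact abs_le.2 ⟨(abs_le.1 (hω 0)).1.trans (le_ciSup (hbdd hω) 0),
      ciSup_le fun n => (abs_le.1 (hω n)).2⟩
  have hui : Integrable u (R : Measure Ω) :=
    Integrable.of_bound hum.aestronglyMeasurable ‖f‖ hub
  have hψ : ∀ n ω, partialSups φ n ω = partialSups (fun k => φ k ω) n := fun n ω =>
    Pi.partialSups_apply φ n ω
  have hψb : ∀ {ω}, (∀ n, |φ n ω| ≤ ‖f‖) → ∀ n, |partialSups φ n ω| ≤ ‖f‖ := by
    intro ω hω n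
    rw [hψ, abs_le]
    exact ⟨(abs_le.1 (hω 0)).1.trans (le_partialSups_of_le (fun k => φ k ω) (Nat.zero_le n)),
      partialSups_le _ _ _ fun k _ => (abs_le.1 (hω k)).2⟩
  have hψm : ∀ n, Measurable (partialSups φ n) := fun n => by
    induction n with
    | zero => rw [partialSups_zero]; exact hφm 0
    | succ n ih => rw [partialSups_add_one]; exact ih.sup (hφm (n + 1))
  have hψu : ∀ᵐ ω ∂(R : Measure Ω), Tendsto (fun n => partialSups φ n ω) atTop (𝓝 (u ω)) := by
    filter_upwards [hb] with ω hω
    simp only [hψ]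
    have e : u ω = ⨆ n, partialSups (fun k => φ k ω) n := (ciSup_partialSups_eq (hbdd hω)).symm
    rw [e]
    exact tendsto_atTop_ciSup (partialSups _).monotone (bddAbove_range_partialSups.2 (hbdd hω))
  -- Finite maxima of conditional losses are again conditional losses, hence have expectation at
  -- most `M`; dominated convergence passes to `u`. So enlarging `u` by one more loss gains nothing.
  have hsup : ∀ Q ∈ equivalents C P, AgreeOn m Q R →
      ∫ ω, max (u ω) (condLoss m f Q ω) ∂(R : Measure Ω) ≤ M := by
    intro Q hQ hag
    have hQm : Measurable (condLoss m f Q) := ((stronglyMeasurable_condLoss f Q).mono hm).measurable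
    have hlim : Tendsto (fun n => ∫ ω, max (partialSups φ n ω) (condLoss m f Q ω) ∂(R : Measure Ω))
        atTop (𝓝 (∫ ω, max (u ω) (condLoss m f Q ω) ∂(R : Measure Ω))) := by
      refine tendsto_integral_of_dominated_convergence (fun _ => ‖f‖) (fun n => ?_)
        (integrable_const _) (fun n => ?_) ?_
      · exact ((hψm n).max hQm).aestronglyMeasurable
      · filter_upwards [hb, abs_condLoss_le f (equivalents_ac hR hQ)] with ω h1 h2
        exact abs_max_le_max_abs_abs.trans (max_le (hψb h1 n) h2)
      · filter_upwards [hψu] with ω hω using hω.max tendsto_const_nhds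
    refine le_of_tendsto' hlim fun n => ?_
    obtain ⟨S, hS, hSR, h⟩ := exists_condLoss_eq_partialSups hm hpaste hR f
      (fun n => (hq n).1) (fun n => (hq n).2) n
    obtain ⟨S', hS', hSR', h'⟩ := exists_condLoss_eq_sup hm hpaste hR f hS hSR hQ hag
    refine le_trans (le_of_eq (integral_congr_ae ?_)) (hM S' hS' hSR')
    filter_upwards [h, h'] with ω h1 h2
    rw [h2, Pi.sup_apply, h1]
  have huM : ∫ ω, u ω ∂(R : Measure Ω) ≤ M := by
    refine le_trans (integral_mono_ae hui ?_ (Eventually.of_forall fun ω => le_max_left _ _))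
      (hsup R hR fun _ _ => rfl)
    exact hui.sup (integrable_condLoss hm f .rfl)
  have hMu : M ≤ ∫ ω, u ω ∂(R : Measure Ω) := by
    refine le_of_tendsto' hv fun n => ?_
    rw [← hqv n]
    beta_reduce
    rw [← (hq n).2.integral_condLoss hm (inUnitBallDual_of_mem_equivalents (hq n).1)]
    refine integral_mono_ae (integrable_condLoss hm f (equivalents_ac hR (hq n).1)) hui ?_
    filter_upwards [hb] with ω hω using le_ciSup (hbdd hω) n
  refine ⟨u, hum, hui, fun Q hQ => ?_, ?_⟩
  -- An arbitrary `Q` is replaced by a model with the same conditional loss that agrees with `R` on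
  -- `m`. Since `E_R u ≥ M`, its loss cannot exceed `u` on a set of positive measure.
  · obtain ⟨Q', hQ', hag, hQQ'⟩ := hfollow Q hQ R hR
    have hQQ : condLoss m f Q' =ᵐ[(R : Measure Ω)] condLoss m f Q :=
      (equivalents_ac hR hQ).ae_le (hQQ' (-f))
    have hci : Integrable (condLoss m f Q') (R : Measure Ω) :=
      integrable_condLoss hm f (equivalents_ac hR hQ')
    have hmi : Integrable (fun ω => max (u ω) (condLoss m f Q' ω)) (R : Measure Ω) := hui.sup hci
    have h0 : ∫ ω, (max (u ω) (condLoss m f Q' ω) - u ω) ∂(R : Measure Ω) = 0 := by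
      refine le_antisymm ?_ (integral_nonneg fun ω => sub_nonneg.2 (le_max_left _ _))
      rw [integral_sub hmi hui]
      linarith [hsup Q' hQ' hag]
    rw [integral_eq_zero_iff_of_nonneg (fun ω => sub_nonneg.2 (le_max_left _ _))
      (hmi.sub hui)] at h0
    filter_upwards [h0, hQQ] with ω h1 h2
    rw [← h2, ← sub_eq_zero.1 h1]
    exact le_max_right _ _
  · obtain ⟨_, ⟨Q, ⟨hQ, hag⟩, rfl⟩, hlt⟩ := exists_lt_of_lt_csSup hTne (sub_lt_self M hε)
    exact ⟨Q, hQ, hag, by linarith⟩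

/-- The essential supremum of the conditional expectations is a conditional risk. -/
lemma condRisk_of_isEssSup (hm : m ≤ mΩ) (hpaste : PastesOn m (equivalents C P))
    (hfollow : FollowsOn m (equivalents C P)) {f : Ω →ᵇ ℝ} {Z : L1c C} (hZ : Z ∈ adapted m C)
    {g : Ω → ℝ} (hg : Z.EqAS P g)
    (h : IsEssSup P {φ | ∃ Q ∈ equivalents C P, φ = condLoss m f Q} g) :
    CondRisk m P (toL1c C f) Z where
  mem := hZ
  dominates Q hQ A hA := by
    have iQ := inUnitBallDual_of_mem_equivalents hQ
    rw [← setIntegral_condLoss hm iQ f hA, L1c.setInt_eq_of_eqAS iQ hQ.1.2 hg]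
    exact setIntegral_mono_ae (integrable_condLoss hm f .rfl).integrableOn
      (Z.integrable_toLp.congr (hg.toLp_ae_eq iQ hQ.1.2)).integrableOn
      (hQ.1.2.ae_le (h.2.1 _ ⟨Q, hQ, rfl⟩))
  approx R hR ε hε := by
    have iR := inUnitBallDual_of_mem_equivalents hR
    obtain ⟨u, hum, hui, hle, Q, hQ, hag, hQu⟩ :=
      exists_upperBound_condLoss hm hpaste hfollow hR f hε
    refine ⟨Q, hQ, hag, le_trans ?_ hQu⟩
    rw [L1c.setInt_eq_of_eqAS iR hR.1.2 hg, Measure.restrict_univ]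
    refine integral_mono_ae (Z.integrable_toLp.congr (hg.toLp_ae_eq iR hR.1.2)) hui ?_
    refine hR.1.2.ae_le (h.2.2 u hum.aemeasurable ?_)
    rintro _ ⟨Q', hQ', rfl⟩
    exact hR.2.ae_le (hle Q' hQ')

end EssentialSupremum

/-! ### Existence of an equivalent model -/

section Existence

variable {Ω : Type} [TopologicalSpace Ω] [MeasurableSpace Ω] [BorelSpace Ω]
  {C : Set (ProbabilityMeasure Ω)} {P : ProbabilityMeasure Ω}

/-- Without equivalent models the representation makes the capacity an empty real supremum, that is
`0`, whereas `P` integrates `1` to `1`. -/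
lemma equivalents_nonempty (hP : InUnitBallDual C P)
    (hrep : ∀ X : Ω →ᵇ ℝ, riskOf C X = riskOf (equivalents C P) X) :
    (equivalents C P).Nonempty := by
  by_contra hne
  rw [not_nonempty_iff_eq_empty] at hne
  have h1 := hP (BoundedContinuousFunction.const Ω 1)
  rw [capacity_eq_equivalents hrep, capacity_eq, hne] at h1
  simp at h1
  linarith

end Existence

/-! ### Path spaces: horizons `∞` and `0` -/

section PathSpace

variable {k : PathKind} {d : ℕ} {C : Set (ProbabilityMeasure (Paths k d))}

/-- The `σ`-algebra `ℱ_s`, for `s ∈ [0, ∞]`, with `ℱ_∞ = ℬ(Ω)`. -/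
@[reducible] def pathSigma (k : PathKind) (d : ℕ) (s : ℝ≥0∞) : MeasurableSpace (Paths k d) :=
  if s = ⊤ then (inferInstance : MeasurableSpace (Paths k d)) else pathFiltration k d s.toNNReal

lemma pathSigma_top : pathSigma k d ⊤ = (inferInstance : MeasurableSpace (Paths k d)) := if_pos rfl

lemma pathSigma_coe (s : ℝ≥0) : pathSigma k d s = pathFiltration k d s :=
  if_neg ENNReal.coe_ne_top

lemma pathSigma_le (s : ℝ≥0∞) : pathSigma k d s ≤ (inferInstance : MeasurableSpace (Paths k d)) := by
  induction s with
  | top => rw [pathSigma_top]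
  | coe s => rw [pathSigma_coe]; exact (pathFiltration k d).le s

lemma pathSigma_mono {r s : ℝ≥0∞} (h : r ≤ s) : pathSigma k d r ≤ pathSigma k d s := by
  induction s with
  | top => rw [pathSigma_top]; exact pathSigma_le r
  | coe s =>
    lift r to ℝ≥0 using ne_top_of_le_ne_top ENNReal.coe_ne_top h
    rw [pathSigma_coe, pathSigma_coe]
    exact (pathFiltration k d).mono (ENNReal.coe_le_coe.1 h)

lemma stronglyMeasurable_cylinder (s : ℝ≥0∞) (g : PathsTo k d s →ᵇ ℝ) :
    StronglyMeasurable[pathSigma k d s] (cylinder s g) := by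
  refine Measurable.stronglyMeasurable ?_
  induction s with
  | top => rw [pathSigma_top]; exact (cylinder ⊤ g).continuous.measurable
  | coe s =>
    rw [pathSigma_coe]
    refine Measurable.mono ?_ ((rawFiltration k d).le_rightCont s) le_rfl
    exact g.continuous.measurable.comp (comap_measurable (Paths.proj (s : ℝ≥0∞)))

lemma L1cTo_le_adapted (s : ℝ≥0∞) : L1cTo C s ≤ adapted (pathSigma k d s) C := by
  refine Submodule.topologicalClosure_mono ?_
  rintro _ ⟨g, rfl⟩
  exact ⟨cylinder s g, stronglyMeasurable_cylinder s g, rfl⟩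

lemma L1cTo_top : L1cTo C ⊤ = ⊤ := by
  have hsurj : ∀ f : Paths k d →ᵇ ℝ, cylinder ⊤ f = f := by
    intro f
    cases k <;> rfl
  refine eq_top_iff.2 fun X _ => ?_
  refine closure_mono ?_ (denseRange_toL1c X)
  rintro _ ⟨f, rfl⟩
  exact ⟨f, by rw [LinearMap.comp_apply, hsurj]⟩

lemma subsingleton_pathsTo_zero : Subsingleton (PathsTo k d 0) := by
  have he : IsEmpty (HalfOpen 0) := ⟨fun u => not_lt_bot u.2⟩
  cases k with
  | cont =>
    refine ⟨fun x y => Subtype.ext (ContinuousMap.ext fun u => ?_)⟩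
    have hu : u = ⟨0, by simp⟩ := Subtype.ext (by simpa using u.2)
    rw [hu, x.2, y.2]
  | cadlag => exact ⟨fun x y => Subtype.ext (funext fun u => he.elim u)⟩
  | cadlagZero =>
    exact ⟨fun x y => Subtype.ext (Subtype.ext (funext fun u => he.elim u))⟩

/-- Functions on `Ω_0` are constant, so `C_b(Ω_0)` lies in the span of `1`, which is closed because
it is finite-dimensional. -/
lemma exists_eq_const_of_mem_L1cTo_zero {Z : L1c C} (hZ : Z ∈ L1cTo C 0) :
    ∃ c : ℝ, Z = toL1c C (BoundedContinuousFunction.const _ c) := by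
  let V : Submodule ℝ (L1c C) := Submodule.span ℝ {toL1c C (BoundedContinuousFunction.const _ 1)}
  have hV : L1cTo C 0 ≤ V := by
    refine Submodule.topologicalClosure_minimal _ ?_ V.closed_of_finiteDimensional
    rintro _ ⟨g, rfl⟩
    refine Submodule.mem_span_singleton.2 ?_
    rcases isEmpty_or_nonempty (Paths k d) with hemp | ⟨⟨x⟩⟩
    · refine ⟨0, ?_⟩
      rw [← map_smul]
      exact congrArg _ (BoundedContinuousFunction.ext fun ω => hemp.elim ω)
    · refine ⟨g (Paths.proj 0 x), ?_⟩
      rw [← map_smul]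
      refine congrArg _ (BoundedContinuousFunction.ext fun ω => ?_)
      have := subsingleton_pathsTo_zero (k := k) (d := d)
      change g (Paths.proj 0 x) * 1 = g (Paths.proj 0 ω)
      rw [mul_one, Subsingleton.elim (Paths.proj 0 x) (Paths.proj 0 ω)]
  obtain ⟨c, rfl⟩ := Submodule.mem_span_singleton.1 (hV hZ)
  refine ⟨c, ?_⟩
  rw [← map_smul]
  refine congrArg _ (BoundedContinuousFunction.ext fun ω => ?_)
  change c * 1 = c
  rw [mul_one]

lemma mul_mem_L1cTo {s : ℝ≥0∞} (f : PathsTo k d s →ᵇ ℝ) {X : L1c C} (hX : X ∈ L1cTo C s) :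
    L1c.mul (cylinder s f) X ∈ L1cTo C s := by
  refine closure_minimal (t := {X : L1c C | L1c.mul (cylinder s f) X ∈ L1cTo C s}) ?_
    ((Submodule.isClosed_topologicalClosure _).preimage (L1c.continuous_mul _)) hX
  rintro _ ⟨g, rfl⟩
  change L1c.mul _ (toL1c C (cylinder s g)) ∈ L1cTo C s
  rw [L1c.mul_toL1c]
  exact Submodule.le_topologicalClosure _ ⟨f * g, rfl⟩

/-- Integrated over the whole space, domination makes the constant an upper bound of the expected
losses, and approximation makes it the least one. No triviality of `F_0` is needed. -/
lemma CondRisk.eq_riskOf {P : ProbabilityMeasure (Paths k d)} (hP : InUnitBallDual C P)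
    (hrep : ∀ X : Paths k d →ᵇ ℝ, riskOf C X = riskOf (equivalents C P) X)
    {X : Paths k d →ᵇ ℝ} {Z : L1c C} (hZ : Z ∈ L1cTo C 0)
    (h : CondRisk (pathSigma k d 0) P (toL1c C X) Z) :
    Z = toL1c C (BoundedContinuousFunction.const _ (riskOf C X)) := by
  obtain ⟨c, rfl⟩ := exists_eq_const_of_mem_L1cTo_zero hZ
  obtain ⟨R, hR⟩ := equivalents_nonempty hP hrep
  have hconst : ∀ Q ∈ equivalents C P,
      L1c.setInt Q univ (toL1c C (BoundedContinuousFunction.const _ c)) = c := by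
    intro Q hQ
    rw [L1c.setInt_toL1c (inUnitBallDual_of_mem_equivalents hQ)]
    simp
  have hX : ∀ Q ∈ equivalents C P,
      L1c.setInt Q univ (-toL1c C X) = ∫ ω, -X ω ∂(Q : Measure (Paths k d)) := by
    intro Q hQ
    rw [map_neg, L1c.setInt_toL1c (inUnitBallDual_of_mem_equivalents hQ), integral_neg,
      Measure.restrict_univ]
  have hle : ∀ Q ∈ equivalents C P, ∫ ω, -X ω ∂(Q : Measure (Paths k d)) ≤ c := fun Q hQ => by
    rw [← hX Q hQ, ← hconst Q hQ]
    exact h.dominates Q hQ univ MeasurableSet.univ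
  have hbdd : BddAbove (range fun Q : equivalents C P =>
      ∫ ω, -X ω ∂((Q : ProbabilityMeasure (Paths k d)) : Measure (Paths k d))) :=
    ⟨c, by rintro _ ⟨⟨Q, hQ⟩, rfl⟩; exact hle Q hQ⟩
  have hc : c = riskOf C X := by
    rw [hrep]
    have : Nonempty (equivalents C P) := ⟨⟨R, hR⟩⟩
    refine le_antisymm (le_of_forall_pos_le_add fun ε hε => ?_) (ciSup_le fun Q => hle Q.1 Q.2)
    obtain ⟨Q, hQ, -, hq⟩ := h.approx R hR ε hε
    rw [hconst R hR, hX Q hQ] at hq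
    exact hq.trans (add_le_add_left (le_ciSup hbdd ⟨Q, hQ⟩) ε)
  rw [← hc]

end PathSpace

end

/-! ### The dynamic risk measure -/

theorem mainTheorem5 (k : PathKind) (d : ℕ) (C : Set (ProbabilityMeasure (Paths k d)))
    (hstable : IsStable (pathFiltration k d) C) (hconvex : IsConvexSet C) (hcompact : IsCompact C)
    (P : ProbabilityMeasure (Paths k d)) (hP : InCanonicalClass C P)
    (hrep : ∀ X : Paths k d →ᵇ ℝ, riskOf C X = riskOf (equivalents C P) X)
    (hdense : ∀ s : ℝ≥0, ∃ D : Set (Cb C), Dense D ∧ ∀ X ∈ D, ∃ Z ∈ L1cTo C s,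
      IsConditionalRisk (pathFiltration k d) C P s X.fn Z) :
    ∃ ρ : (s : ℝ≥0∞) → L1c C → L1cTo C s,
      (∀ (s : ℝ≥0) (X : Paths k d →ᵇ ℝ),
        IsConditionalRisk (pathFiltration k d) C P s X (ρ s (toL1c C X))) ∧
      (∀ s, Continuous (ρ s)) ∧
      FactorizesInto C ρ ∧
      ∀ r s : ℝ≥0∞, r ≤ s → ∀ X : L1c C, ρ r X = ρ r (-(ρ s X : L1c C)) := by
  have hpaste : ∀ s : ℝ≥0, PastesOn (pathSigma k d s) (equivalents C P) := fun s => by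
    rw [pathSigma_coe]; exact hstable.pastesOn P s
  have hfollow : ∀ s : ℝ≥0, FollowsOn (pathSigma k d s) (equivalents C P) := fun s => by
    rw [pathSigma_coe]; exact hstable.followsOn P s
  have hex : ∀ s : ℝ≥0∞, ∀ X : L1c C, ∃ Z ∈ L1cTo C s, CondRisk (pathSigma k d s) P X Z := by
    intro s X
    induction s with
    | top =>
      have hX : ∀ Y : L1c C, Y ∈ L1cTo C ⊤ := fun Y => by rw [L1cTo_top]; trivial
      exact ⟨-X, hX _, condRisk_neg (L1cTo_le_adapted ⊤ (hX X))⟩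
    | coe s =>
      obtain ⟨D, hD, hDZ⟩ := hdense s
      refine exists_condRisk_of_dense hrep (pathSigma_le s) (hpaste s)
        (Submodule.isClosed_topologicalClosure _) (L1cTo_le_adapted s)
        (UniformSpace.Completion.denseRange_coe.dense_image
          (UniformSpace.Completion.continuous_coe (Cb C)) hD) ?_ X
      rintro _ ⟨Y, hY, rfl⟩
      obtain ⟨Z, hZ, g, hg, hsup⟩ := hDZ Y hY
      refine ⟨Z, hZ, condRisk_of_isEssSup (f := Y.fn) (pathSigma_le s) (hpaste s) (hfollow s)
        (L1cTo_le_adapted s hZ) hg ?_⟩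
      rw [pathSigma_coe]
      exact hsup
  choose Z hZ hZX using hex
  -- By uniqueness an identity for `Z` is proved by exhibiting a conditional risk; by minimality an
  -- upper bound, by exhibiting an adapted dominating element.
  have huniq : ∀ {s X W}, CondRisk (pathSigma k d s) P X W → Z s X = W := fun h =>
    (hZX _ _).unique hrep (pathSigma_le _) h
  have hle : ∀ {s X W}, W ∈ L1cTo C s → DominatesRisk (pathSigma k d s) P X W →
      L1c.Le (Z s X) W := fun hW h =>
    (hZX _ _).le hrep (pathSigma_le _) (L1cTo_le_adapted _ hW) h
  have hcons : ∀ r s, r ≤ s → ∀ X, Z r X = Z r (-Z s X) := fun r s hrs X =>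
    huniq ((hZX s X).trans (pathSigma_mono hrs) (hZX r _))
  have hsub : ∀ s X Y, DominatesRisk (pathSigma k d s) P (X + Y) (Z s X + Z s Y) := fun s X Y =>
    (hZX s X).dominates.add (hZX s Y).dominates
  have hsmul : ∀ s X (a : ℝ), 0 ≤ a → Z s (a • X) = a • Z s X := fun s X a ha =>
    huniq ((hZX s X).smul ha)
  refine ⟨fun s X => ⟨Z s X, hZ s X⟩, fun s X => ?_, fun s => ?_, ⟨⟨?_, ?_, ?_, ?_, ?_, ?_⟩, ?_, ?_⟩,
    fun r s hrs X => Subtype.ext (hcons r s hrs X)⟩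
  · refine ⟨_, L1c.eqAS_toLp hP.1 (Z s (toL1c C X)), ?_⟩
    have := (hZX s (toL1c C X)).isEssSup (pathSigma_le s) hP.1 (equivalents_nonempty hP.1 hrep)
    rw [pathSigma_coe] at this
    exact this
  · refine Continuous.subtype_mk ?_ _
    induction s with
    | top =>
      have e : Z ⊤ = fun X => -X := funext fun X =>
        huniq (condRisk_neg (L1cTo_le_adapted ⊤ (by rw [L1cTo_top]; trivial)))
      rw [e]
      exact continuous_neg
    | coe s =>
      refine (LipschitzWith.of_dist_le_mul (K := 1) fun X Y => ?_).continuous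
      rw [NNReal.coe_one, one_mul, dist_eq_norm, dist_eq_norm]
      exact (hZX s X).norm_sub_le hrep (pathSigma_le s) (hpaste s) (hZX s Y)
  · exact fun s X Y hXY => (hZX s X).anti hrep (pathSigma_le s) (hZX s Y) hXY
  · exact fun s X Y => Subtype.ext
      (huniq ((hZX s X).add_adapted (pathSigma_le s) (L1cTo_le_adapted s Y.2)))
  · intro s X Y a ha ha'
    refine hle ((L1cTo C s).add_mem ((L1cTo C s).smul_mem a (hZ s X))
      ((L1cTo C s).smul_mem (1 - a) (hZ s Y))) ?_
    -- Homogeneity moves the weights inside, so that convexity becomes subadditivity.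
    rw [← hsmul s X a ha, ← hsmul s Y (1 - a) (sub_nonneg.2 ha')]
    exact hsub s _ _
  · exact fun s X Y => hle ((L1cTo C s).add_mem (hZ s X) (hZ s Y)) (hsub s X Y)
  · exact fun s X a ha => Subtype.ext (hsmul s X a ha)
  · exact fun r s hrs X => Subtype.ext (hcons r s hrs X)
  · exact fun s f hf X => hle (mul_mem_L1cTo f (hZ s X))
      ((hZX s X).dominates.mul (pathSigma_le s) (stronglyMeasurable_cylinder s f)
        fun ω => hf (Paths.proj s ω))
  · exact fun X => (hZX 0 (toL1c C X)).eq_riskOf hP.1 hrep (hZ 0 _)
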